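/- **Notation.** $U_n$ is uniform on $\{0,1\}^n$, $\Delta$ is statistical distance, and $\Delta(X;U\mid Z)$ denotes $\Delta((X,Z);(U,Z))$ with $U$ independent of $Z$. An $(n,k)$-source is a random variable on $\{0,1\}^n$ with min-entropy $-\log_2\max_x\Pr[X=x]\ge k$. A function $E:\{0,1\}^{n_1}\times\{0,1\}^{n_2}\to\{0,1\}^m$ is a $[(n_1,k_1),(n_2,k_2)\mapsto m\sim\varepsilon]$ *strong non-malleable extractor* if for all independent $(n_1,k_1)$-sources $X$ and $(n_2,k_2)$-sources $Y$ one has $\Delta(E(X,Y);U_m)\le\varepsilon$ and, for all $f:\{0,1\}^{n_1}\to\{0,1\}^{n_1}$, $g:\{0,1\}^{n_2}\to\{0,1\}^{n_2}$ at least one of which has no fixed point, the distances of $E(X,Y)$ from $U_m$ given $E(f(X),g(Y))$, given $(E(f(X),g(Y)),Y)$, and given $(E(f(X),g(Y)),X)$ are all at most $\varepsilon$. **Protocols.** In an $r$-round protocol Alice holds $(W,A)$ and Bob holds $(W,B)$, where $W$ is an $(\ell_1,k_1)$-source, $A,B$ are $(\ell,k)$-sources, and $W,A,B$ are independent. First Eve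 picks one party and a function $F:\{0,1\}^{\ell_1}\times\{0,1\}^{\ell}\to\{0,1\}^{\ell_1}\times\{0,1\}^{\ell}$, and the memory of that party is replaced by its image under $F$. Then messages $C_1,\dots,C_r$ are sent, the odd ones by Alice and the even ones by Bob, each a deterministic function of the sender's memory and the messages received so far; Eve replaces $C_i$ by $C_i'$, chosen from $(C_1,C_1',\dots,C_{i-1},C_{i-1}',C_i)$ and independent random coins. Finally Alice outputs $S_A$ and Bob outputs $S_B$ in $\{0,1\}^m\cup\{\bot\}$, each a deterministic function of the party's memory and of the messages it received. Let $C=(C_1,C_1',\dots,C_r,C_r')$. The protocol is an $(r,\ell_1,k_1,\ell,k,m,\varepsilon',\delta)$-*privacy amplification protocol against memory-tampering active adversaries* if for all such sources: * (passive Eve: $F=\mathrm{id}$, $C_i'=C_i$) always $S_A=S_B\ne\bot$, and $\Delta(S_A;U_m\mid C)\le\varepsilon'$; * (active Eve, arbitrary as above) there is an event $G$ with $\Pr[G]\ge1-\delta$ on which $S_A=\bot$, or $S_B=\bot$, or $S_A=S_B\neq\bot$, and such that, conditioned on $G\cap\{S_A\ne\bot,\ S_B\neq\bot\}$ (if this has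 positive probability), $\Delta(S_A;U_m\mid C)\le\varepsilon'$. **Theorem.** For every constant $\kappa>2$ there are constants $c,K>0$ such that the following holds. Let $\ell_1,\ell_2,\alpha$ be non-negative integers and let $k_1,\gamma,\varepsilon$ be real numbers with $\gamma>0$, $\ell_2\ge K\log_2\ell_1$ and $\alpha\ge\kappa\log_2\ell_2$ (with the convention $\log_2 0=0$). Suppose that there is a $$[(\ell_1,\;k_1-2\ell_2-2\gamma-1),\ (2\ell_2,\;\ell_2-\gamma-1)\ \mapsto\ 4\alpha\ \sim\ \varepsilon]$$ strong non-malleable extractor. Then there exists an $(r,\ell_1,k_1,2\ell_2,2\ell_2,m,\varepsilon',\delta)$-privacy amplification protocol against memory-tampering active adversaries with $$r=6,\qquad m=\max\{0,\lfloor0.999\,(k_1-2\ell_2-\gamma)\rfloor\},\qquad \varepsilon'=2^{-c\ell_2},\qquad \delta=\varepsilon+2^{-\alpha}+2\cdot2^{-\gamma}+2^{-c\alpha}.$$ -/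

import Mathlib

noncomputable section

namespace MemTamper

/-- Bit strings of length `n`. -/
abbrev Bits (n : ℕ) : Type := Fin n → Bool

/-- The uniform distribution on `n`-bit strings. -/
def unif (n : ℕ) : PMF (Bits n) := PMF.uniformOfFintype (Bits n)

/-- The joint distribution of two independent random variables. -/
def indep {S T : Type*} (X : PMF S) (Y : PMF T) : PMF (S × T) :=
  X.bind fun x => Y.map fun y => (x, y)

/-- Statistical distance of two discrete distributions. -/
def statDist {S : Type*} (X Y : PMF S) : ℝ :=
  (1 / 2) * ∑' s, |(X s).toReal - (Y s).toReal|

/-- The distance between `(S, Z)` and `(U, Z)`, where `S` and `Z` are random variables on the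
probability space `P` and `U` is independent of `Z`. -/
def distGiven {Ω S T : Type*} (P : PMF Ω) (X : Ω → S) (U : PMF S) (Z : Ω → T) : ℝ :=
  statDist (P.map fun ω => (X ω, Z ω)) (indep U (P.map Z))

/-- Min-entropy, in bits. -/
def minEntropy {n : ℕ} (X : PMF (Bits n)) : ℝ :=
  -Real.logb 2 (⨆ x, (X x).toReal)

/-- `X` is an `(n, k)`-source. -/
def IsSource {n : ℕ} (k : ℝ) (X : PMF (Bits n)) : Prop := k ≤ minEntropy X

theorem isSource_iff {n : ℕ} (k : ℝ) (X : PMF (Bits n)) :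
    IsSource k X ↔ ∀ x, (X x).toReal ≤ (2 : ℝ) ^ (-k) := by
  have hb : BddAbove (Set.range fun x => (X x).toReal) := (Set.finite_range _).bddAbove
  obtain ⟨x0, hx0⟩ := X.support_nonempty
  have hpos : 0 < (X x0).toReal :=
    ENNReal.toReal_pos ((PMF.mem_support_iff X x0).1 hx0) (X.apply_ne_top x0)
  have hsup : 0 < ⨆ x, (X x).toReal := lt_of_lt_of_le hpos (le_ciSup hb x0)
  unfold IsSource minEntropy
  rw [le_neg, Real.logb_le_iff_le_rpow (by norm_num) hsup]
  exact ⟨fun h x => (le_ciSup hb x).trans h, fun h => ciSup_le h⟩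

/-- A function without fixed points. -/
def FixedPointFree {S : Type*} (f : S → S) : Prop := ∀ x, f x ≠ x

/-! ### Two-source non-malleable extractors -/

section Extractors

variable {n₁ n₂ m : ℕ}

/-- `E` is a two-source extractor `[(n₁, k₁), (n₂, k₂) ↦ m ∼ ε]`. -/
def IsTwoSourceExtractor (k₁ k₂ ε : ℝ) (E : Bits n₁ → Bits n₂ → Bits m) : Prop :=
  ∀ (X : PMF (Bits n₁)) (Y : PMF (Bits n₂)), IsSource k₁ X → IsSource k₂ Y →
    statDist ((indep X Y).map fun p => E p.1 p.2) (unif m) ≤ ε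

/-- The common form of the non-malleability conditions: `E(X, Y)` is `ε`-close to uniform given
`E(f(X), g(Y))` and the extra information `Z(X, Y)`, whenever `f` or `g` has no fixed point. -/
def NonMalleableGiven {T : Type} (k₁ k₂ ε : ℝ) (E : Bits n₁ → Bits n₂ → Bits m)
    (Z : Bits n₁ × Bits n₂ → T) : Prop :=
  ∀ (X : PMF (Bits n₁)) (Y : PMF (Bits n₂)), IsSource k₁ X → IsSource k₂ Y →
    ∀ (f : Bits n₁ → Bits n₁) (g : Bits n₂ → Bits n₂),
      FixedPointFree f ∨ FixedPointFree g →
        distGiven (indep X Y) (fun p => E p.1 p.2) (unif m)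
          (fun p => (E (f p.1) (g p.2), Z p)) ≤ ε

/-- A two-source non-malleable extractor. -/
def IsNonMalleable (k₁ k₂ ε : ℝ) (E : Bits n₁ → Bits n₂ → Bits m) : Prop :=
  IsTwoSourceExtractor k₁ k₂ ε E ∧ NonMalleableGiven k₁ k₂ ε E fun _ => ()

/-- A strong two-source non-malleable extractor: right strong (the second source is revealed)
and left strong (the first source is revealed). -/
def IsStrongNonMalleable (k₁ k₂ ε : ℝ) (E : Bits n₁ → Bits n₂ → Bits m) : Prop :=
  IsNonMalleable k₁ k₂ ε E ∧
    NonMalleableGiven k₁ k₂ ε E (fun p => p.2) ∧ NonMalleableGiven k₁ k₂ ε E (fun p => p.1)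

end Extractors

/-! ### Protocols -/

/-- A protocol with `r` rounds. The secret has `ℓ₁` bits, each randomness tape has `ℓ` bits, and
the outputs are `m`-bit strings or `none` (abort). Alice sends the odd-numbered messages and Bob
the even-numbered ones. A message is a deterministic function of the memory of its sender and of
the list of messages which the sender has received so far (its length tells the round), and an
output is a deterministic function of the memory and of all messages received. All messages are
bit strings, padded to a common length. -/
structure Protocol (r ℓ₁ ℓ m : ℕ) where
  msgLen : ℕ
  sendA : Bits ℓ₁ → Bits ℓ → List (Bits msgLen) → Bits msgLen
  sendB : Bits ℓ₁ → Bits ℓ → List (Bits msgLen) → Bits msgLen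
  outA : Bits ℓ₁ → Bits ℓ → List (Bits msgLen) → Option (Bits m)
  outB : Bits ℓ₁ → Bits ℓ → List (Bits msgLen) → Option (Bits m)

/-- The entries number 1, 3, 5, … of a list. -/
def everyOther {S : Type*} : List S → List S
  | [] => []
  | [x] => [x]
  | x :: _ :: t => x :: everyOther t

/-- The two honest parties. -/
inductive Party
  | alice
  | bob

/-- The memories `((W, A), (W, B))` of Alice and Bob after Eve has applied `F` to the memory of
the party that she corrupts. -/
def corrupt {ℓ₁ ℓ : ℕ} (v : Party) (F : Bits ℓ₁ × Bits ℓ → Bits ℓ₁ × Bits ℓ)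
    (w : Bits ℓ₁) (a b : Bits ℓ) : (Bits ℓ₁ × Bits ℓ) × (Bits ℓ₁ × Bits ℓ) :=
  match v with
  | .alice => (F (w, a), (w, b))
  | .bob => ((w, a), F (w, b))

namespace Protocol

variable {r ℓ₁ ℓ m : ℕ} (P : Protocol r ℓ₁ ℓ m)

/-- A transcript `(C₁, C'₁), (C₂, C'₂), …`: messages sent, with the messages delivered. -/
abbrev View : Type := List (Bits P.msgLen × Bits P.msgLen)

/-- A (deterministic) strategy of Eve on the channel: from `(C₁, C'₁, …, Cᵢ₋₁, C'ᵢ₋₁)` and `Cᵢ`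
she determines `C'ᵢ`. -/
abbrev Strategy : Type := P.View → Bits P.msgLen → Bits P.msgLen

/-- The messages `C'₂, C'₄, …` received by Alice. -/
def recvA (t : P.View) : List (Bits P.msgLen) := (everyOther t.tail).map Prod.snd

/-- The messages `C'₁, C'₃, …` received by Bob. -/
def recvB (t : P.View) : List (Bits P.msgLen) := (everyOther t).map Prod.snd

/-- The transcript of the first `i` rounds, for memories `x.1` of Alice and `x.2` of Bob. -/
def transcript (eve : P.Strategy) (x : (Bits ℓ₁ × Bits ℓ) × (Bits ℓ₁ × Bits ℓ)) : ℕ → P.View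
  | 0 => []
  | i + 1 =>
    let t := transcript eve x i
    let c := if i % 2 = 0 then P.sendA x.1.1 x.1.2 (P.recvA t)
      else P.sendB x.2.1 x.2.2 (P.recvB t)
    t ++ [(c, eve t c)]

/-- The view of Eve: the transcript of all `r` rounds. -/
def view (eve : P.Strategy) (x : (Bits ℓ₁ × Bits ℓ) × (Bits ℓ₁ × Bits ℓ)) : P.View :=
  P.transcript eve x r

/-- The output `S_A` of Alice. -/
def keyA (eve : P.Strategy) (x : (Bits ℓ₁ × Bits ℓ) × (Bits ℓ₁ × Bits ℓ)) : Option (Bits m) :=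
  P.outA x.1.1 x.1.2 (P.recvA (P.view eve x))

/-- The output `S_B` of Bob. -/
def keyB (eve : P.Strategy) (x : (Bits ℓ₁ × Bits ℓ) × (Bits ℓ₁ × Bits ℓ)) : Option (Bits m) :=
  P.outB x.2.1 x.2.2 (P.recvB (P.view eve x))

/-- A passive Eve delivers every message unchanged. -/
def passiveEve : P.Strategy := fun _ c => c

/-- If Eve is passive, then Alice and Bob always output the same string `S_A = S_B ≠ ⊥`, and it is
`ε`-close to uniform given the view of Eve. -/
def PassiveSecure (k₁ k₂ ε : ℝ) : Prop :=
  ∀ (W : PMF (Bits ℓ₁)) (A B : PMF (Bits ℓ)), IsSource k₁ W → IsSource k₂ A → IsSource k₂ B →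
    let D := indep W (indep A B)
    let x := fun ω : Bits ℓ₁ × Bits ℓ × Bits ℓ => ((ω.1, ω.2.1), (ω.1, ω.2.2))
    (∀ ω ∈ D.support, P.keyA P.passiveEve (x ω) = P.keyB P.passiveEve (x ω) ∧
      P.keyA P.passiveEve (x ω) ≠ none) ∧
    distGiven D (fun ω => P.keyA P.passiveEve (x ω)) ((unif m).map some)
      (fun ω => P.view P.passiveEve (x ω)) ≤ ε

/-- If Eve is active, that is, she replaces the memory of the party `v` by its image under `F` and
plays an arbitrary strategy with independent random coins, then with probability at least `1 - δ`
one of Alice and Bob aborts or they output the same string, `ε`-close to uniform given the view of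
Eve: there is an event `G` of probability at least `1 - δ` on which `S_A = ⊥` or `S_B = ⊥` or
`S_A = S_B`, and, conditioned on the part of `G` where nobody aborts (if this has positive
probability), `S_A` is `ε`-close to uniform given the view of Eve. -/
def ActiveSecure (k₁ k₂ ε δ : ℝ) : Prop :=
  ∀ (W : PMF (Bits ℓ₁)) (A B : PMF (Bits ℓ)), IsSource k₁ W → IsSource k₂ A → IsSource k₂ B →
  ∀ (v : Party) (F : Bits ℓ₁ × Bits ℓ → Bits ℓ₁ × Bits ℓ)
    (R : Type) (coins : PMF R) (eve : R → P.Strategy),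
    let D := indep (indep W (indep A B)) coins
    let x := fun ω : (Bits ℓ₁ × Bits ℓ × Bits ℓ) × R => corrupt v F ω.1.1 ω.1.2.1 ω.1.2.2
    let SA := fun ω => P.keyA (eve ω.2) (x ω)
    let SB := fun ω => P.keyB (eve ω.2) (x ω)
    let C := fun ω => P.view (eve ω.2) (x ω)
    ∃ G : Set ((Bits ℓ₁ × Bits ℓ × Bits ℓ) × R),
      1 - δ ≤ (D.toOuterMeasure G).toReal ∧
      (∀ ω ∈ G, SA ω = none ∨ SB ω = none ∨ SA ω = SB ω) ∧
      ∀ hH : ∃ ω ∈ G ∩ {ω | SA ω ≠ none ∧ SB ω ≠ none}, ω ∈ D.support,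
        distGiven (D.filter (G ∩ {ω | SA ω ≠ none ∧ SB ω ≠ none}) hH) SA
          ((unif m).map some) C ≤ ε

/-- `P` is an `(r, ℓ₁, k₁, ℓ, k₂, m, ε, δ)`-privacy amplification protocol against
memory-tampering active adversaries. -/
def IsPrivacyAmplification (k₁ k₂ ε δ : ℝ) : Prop :=
  P.PassiveSecure k₁ k₂ ε ∧ P.ActiveSecure k₁ k₂ ε δ

end Protocol

end MemTamper

end

noncomputable section

namespace MemTamper

set_option linter.unusedSectionVars false

/-! The tapes have length and min-entropy `2 * ℓ₂`, so they are exactly uniform, and each splits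
into a first part of `ℓ₂` bits, a short seed and a remainder. The parties exchange the first parts,
feed both of them with the secret into the non-malleable extractor `E`, and cut the output into a
key `(x, y₁, y₂)`. They then exchange the seeds with one-time tags: a polynomial hash at `x`, masked
by `y₁` for Alice and by `y₂` for Bob. The output is extracted from the secret with the sum of the
two seeds. Four rounds suffice; the other two are padding.

Authentication (`sum_ev_bad_le`, `ev_fooled_le`). Once the corrupted party's original tape is fixed,
its new memory depends only on `W`. Its new first part and seed are treated as leakage about `W`,
and the secret is conditioned on this leakage and on whether the secret was changed. Unlikely cells
are charged to the error. In every other cell `W` keeps enough entropy, while the honest first part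
is uniform. If the two parties feed different inputs to `E`, non-malleability makes the honest key
nearly uniform given the other key, and the received tag verifies for few honest keys. If the inputs
agree, both keys coincide and are nearly uniform, and few keys allow an alteration of the tagged
seeds to pass (`sum_ind_forgeries_le`).

Secrecy (`sum_ext_le`, `ev_honest_bias_le`). When nothing was altered, the view is determined by the
honest tape and by bounded leakage about `W`: the corrupted first part and seed, a flag and the key.
The honest seed is uniform, so the sum of the seeds is a uniform seed for each leakage value. A
random function is an extractor such that each test is biased on few secrets only
(`exists_seededExtractor`), so a union over leakage values costs their number and nothing else.

Finally (`activeSecure`), the event `G` contains the aborts, and also the undisturbed runs if these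
have probability more than `ρ`; conditioning then multiplies the distance by at most `1 / ρ`. -/

/-- The expectation of a real-valued function. -/
def ev {Ω : Type*} (P : PMF Ω) (φ : Ω → ℝ) : ℝ := ∑' ω, (P ω).toReal * φ ω

/-! ### Expectations, tests and statistical distance -/

section Expectation

variable {Ω S : Type*}

theorem summable_toReal (P : PMF Ω) : Summable fun ω => (P ω).toReal :=
  ENNReal.summable_toReal (by rw [P.tsum_coe]; exact ENNReal.one_ne_top)

theorem tsum_toReal (P : PMF Ω) : ∑' ω, (P ω).toReal = 1 := by
  rw [← ENNReal.tsum_toReal_eq fun ω => P.apply_ne_top ω, P.tsum_coe, ENNReal.toReal_one]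

theorem summable_ev (P : PMF Ω) {φ : Ω → ℝ} {M : ℝ} (hφ : ∀ ω, |φ ω| ≤ M) :
    Summable fun ω => (P ω).toReal * φ ω := by
  refine Summable.of_norm_bounded ((summable_toReal P).mul_right M) fun ω => ?_
  rw [Real.norm_eq_abs, abs_mul, abs_of_nonneg ENNReal.toReal_nonneg]
  exact mul_le_mul_of_nonneg_left (hφ ω) ENNReal.toReal_nonneg

theorem ev_fintype [Fintype Ω] (P : PMF Ω) (φ : Ω → ℝ) :
    ev P φ = ∑ ω, (P ω).toReal * φ ω := tsum_fintype _

theorem ev_const (P : PMF Ω) (a : ℝ) : ev P (fun _ => a) = a := by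
  rw [ev, tsum_mul_right, tsum_toReal, one_mul]

theorem ev_mono (P : PMF Ω) {φ ψ : Ω → ℝ} {M M' : ℝ} (hφ : ∀ ω, |φ ω| ≤ M)
    (hψ : ∀ ω, |ψ ω| ≤ M') (h : ∀ ω, φ ω ≤ ψ ω) : ev P φ ≤ ev P ψ :=
  (summable_ev P hφ).tsum_le_tsum
    (fun ω => mul_le_mul_of_nonneg_left (h ω) ENNReal.toReal_nonneg) (summable_ev P hψ)

theorem ev_le (P : PMF Ω) {φ : Ω → ℝ} {M a : ℝ} (hφ : ∀ ω, |φ ω| ≤ M) (h : ∀ ω, φ ω ≤ a) :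
    ev P φ ≤ a :=
  (ev_mono P hφ (fun _ => le_refl |a|) h).trans_eq (ev_const P a)

theorem ev_nonneg (P : PMF Ω) {φ : Ω → ℝ} (h : ∀ ω, 0 ≤ φ ω) : 0 ≤ ev P φ :=
  tsum_nonneg fun ω => mul_nonneg ENNReal.toReal_nonneg (h ω)

theorem abs_ev_le (P : PMF Ω) {φ : Ω → ℝ} {M : ℝ} (hφ : ∀ ω, |φ ω| ≤ M) : |ev P φ| ≤ M := by
  refine abs_le.2 ⟨?_, ev_le P hφ fun ω => (abs_le.1 (hφ ω)).2⟩
  rw [← ev_const P (-M)]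
  exact ev_mono P (fun _ => le_refl |-M|) hφ fun ω => (abs_le.1 (hφ ω)).1

theorem ev_add (P : PMF Ω) {φ ψ : Ω → ℝ} {M M' : ℝ} (hφ : ∀ ω, |φ ω| ≤ M)
    (hψ : ∀ ω, |ψ ω| ≤ M') : ev P (fun ω => φ ω + ψ ω) = ev P φ + ev P ψ := by
  rw [ev, ev, ev, ← (summable_ev P hφ).tsum_add (summable_ev P hψ)]
  exact tsum_congr fun ω => mul_add _ _ _

theorem ev_sub (P : PMF Ω) {φ ψ : Ω → ℝ} {M M' : ℝ} (hφ : ∀ ω, |φ ω| ≤ M)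
    (hψ : ∀ ω, |ψ ω| ≤ M') : ev P (fun ω => φ ω - ψ ω) = ev P φ - ev P ψ := by
  rw [ev, ev, ev, ← (summable_ev P hφ).tsum_sub (summable_ev P hψ)]
  exact tsum_congr fun ω => mul_sub _ _ _

theorem ev_pure (a : Ω) (φ : Ω → ℝ) : ev (PMF.pure a) φ = φ a := by
  rw [ev, tsum_eq_single a]
  · simp
  · intro b hb
    simp [PMF.pure_apply, hb]

theorem ev_bind (P : PMF Ω) (f : Ω → PMF S) {φ : S → ℝ} {M : ℝ} (hφ : ∀ s, |φ s| ≤ M) :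
    ev (P.bind f) φ = ev P fun ω => ev (f ω) φ := by
  have hsum : Summable fun p : Ω × S => (P p.1).toReal * ((f p.1 p.2).toReal * φ p.2) := by
    have h1 : Summable fun p : Ω × S => (P p.1).toReal * (f p.1 p.2).toReal := by
      have h0 : 0 ≤ fun p : Ω × S => (P p.1).toReal * (f p.1 p.2).toReal :=
        fun p => mul_nonneg ENNReal.toReal_nonneg ENNReal.toReal_nonneg
      rw [summable_prod_of_nonneg h0]
      constructor
      · intro ω
        exact (summable_toReal (f ω)).mul_left (P ω).toReal
      · simp only [tsum_mul_left, tsum_toReal, mul_one]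
        exact summable_toReal P
    refine Summable.of_norm_bounded (h1.mul_right M) fun p => ?_
    rw [← mul_assoc, Real.norm_eq_abs, abs_mul,
      abs_of_nonneg (mul_nonneg ENNReal.toReal_nonneg ENNReal.toReal_nonneg)]
    exact mul_le_mul_of_nonneg_left (hφ _)
      (mul_nonneg ENNReal.toReal_nonneg ENNReal.toReal_nonneg)
  have h2 : ∀ s, ((P.bind f) s).toReal * φ s =
      ∑' ω, (P ω).toReal * ((f ω s).toReal * φ s) := by
    intro s
    rw [PMF.bind_apply, ENNReal.tsum_toReal_eq fun ω =>
      ENNReal.mul_ne_top (P.apply_ne_top ω) ((f ω).apply_ne_top s), ← tsum_mul_right]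
    exact tsum_congr fun ω => by rw [ENNReal.toReal_mul, mul_assoc]
  have h3 : ∀ ω, (P ω).toReal * ev (f ω) φ =
      ∑' s, (P ω).toReal * ((f ω s).toReal * φ s) := fun ω => by rw [ev, tsum_mul_left]
  have h4 : ∑' s, ∑' ω, (P ω).toReal * ((f ω s).toReal * φ s) =
      ∑' ω, ∑' s, (P ω).toReal * ((f ω s).toReal * φ s) :=
    Summable.tsum_comm (f := fun ω s => (P ω).toReal * ((f ω s).toReal * φ s)) hsum
  unfold ev at h3 ⊢
  rw [tsum_congr h2, h4]
  exact (tsum_congr h3).symm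

theorem ev_map (P : PMF Ω) (f : Ω → S) {φ : S → ℝ} {M : ℝ} (hφ : ∀ s, |φ s| ≤ M) :
    ev (P.map f) φ = ev P fun ω => φ (f ω) := by
  rw [← PMF.bind_pure_comp, ev_bind P _ hφ]
  simp only [Function.comp_apply, ev_pure]

theorem ev_indep (P : PMF Ω) (Q : PMF S) {φ : Ω × S → ℝ} {M : ℝ} (hφ : ∀ s, |φ s| ≤ M) :
    ev (indep P Q) φ = ev P fun ω => ev Q fun s => φ (ω, s) := by
  rw [indep, ev_bind P _ hφ]
  simp only [ev_map Q _ hφ]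

theorem ev_indep_swap (P : PMF Ω) (Q : PMF S) {φ : Ω × S → ℝ} {M : ℝ} (hφ : ∀ s, |φ s| ≤ M) :
    ev (indep P Q) φ = ev Q fun s => ev P fun ω => φ (ω, s) := by
  have h : indep P Q = Q.bind fun s => P.map fun ω => (ω, s) := by
    simp only [indep, ← PMF.bind_pure_comp]
    exact PMF.bind_comm _ _ _
  rw [h, ev_bind Q _ hφ]
  simp only [ev_map P _ hφ]

open Classical in
/-- The indicator function of a set. -/
def ind (T : Set Ω) (ω : Ω) : ℝ := if ω ∈ T then 1 else 0

theorem ind_nonneg (T : Set Ω) (ω : Ω) : 0 ≤ ind T ω := by unfold ind; split_ifs <;> norm_num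
theorem ind_le_one (T : Set Ω) (ω : Ω) : ind T ω ≤ 1 := by unfold ind; split_ifs <;> norm_num
theorem abs_ind_le (T : Set Ω) (ω : Ω) : |ind T ω| ≤ 1 :=
  abs_le.2 ⟨by linarith [ind_nonneg T ω], ind_le_one T ω⟩
theorem ind_of_mem {T : Set Ω} {ω : Ω} (h : ω ∈ T) : ind T ω = 1 := if_pos h
theorem ind_of_notMem {T : Set Ω} {ω : Ω} (h : ω ∉ T) : ind T ω = 0 := if_neg h

theorem toOuterMeasure_toReal (P : PMF Ω) (T : Set Ω) :
    (P.toOuterMeasure T).toReal = ev P (ind T) := by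
  rw [PMF.toOuterMeasure_apply, ENNReal.tsum_toReal_eq]
  · refine tsum_congr fun ω => ?_
    by_cases h : ω ∈ T
    · simp [ind, h]
    · simp [ind, h]
  · intro ω
    by_cases h : ω ∈ T
    · simp [h, P.apply_ne_top]
    · simp [h]

theorem ev_filter (P : PMF Ω) (T : Set Ω) (hT : ∃ ω ∈ T, ω ∈ P.support) (φ : Ω → ℝ) :
    ev (P.filter T hT) φ = (ev P fun ω => ind T ω * φ ω) / ev P (ind T) := by
  have h0 : ∑' ω, T.indicator P ω ≠ ⊤ := by
    rw [← PMF.toOuterMeasure_apply]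
    exact ne_top_of_le_ne_top ENNReal.one_ne_top
      ((P.toOuterMeasure.mono (Set.subset_univ T)).trans (by simp [PMF.toOuterMeasure_apply]))
  rw [← toOuterMeasure_toReal, PMF.toOuterMeasure_apply, div_eq_mul_inv, ev, ev,
    ← tsum_mul_right]
  refine tsum_congr fun ω => ?_
  rw [PMF.filter_apply, ENNReal.toReal_mul, ENNReal.toReal_inv]
  by_cases h : ω ∈ T
  · simp only [h, Set.indicator_of_mem, ind_of_mem]; ring
  · simp [h, ind_of_notMem]

theorem ev_ind_pos (P : PMF Ω) (T : Set Ω) (hT : ∃ ω ∈ T, ω ∈ P.support) :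
    0 < ev P (ind T) := by
  obtain ⟨ω, hω, hs⟩ := hT
  refine (summable_ev P (abs_ind_le T)).tsum_pos
    (fun i => mul_nonneg ENNReal.toReal_nonneg (ind_nonneg T i)) ω ?_
  rw [ind_of_mem hω, mul_one]
  exact ENNReal.toReal_pos ((PMF.mem_support_iff P ω).1 hs) (P.apply_ne_top ω)

theorem summable_statDist (X Y : PMF S) :
    Summable fun s => |(X s).toReal - (Y s).toReal| :=
  ((summable_toReal X).sub (summable_toReal Y)).abs

theorem statDist_nonneg (X Y : PMF S) : 0 ≤ statDist X Y :=
  mul_nonneg (by norm_num) (tsum_nonneg fun _ => abs_nonneg _)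

theorem ev_ind_sub_le_statDist (X Y : PMF S) (T : Set S) :
    ev X (ind T) - ev Y (ind T) ≤ statDist X Y := by
  have h1 := summable_ev X (abs_ind_le T)
  have h2 := summable_ev Y (abs_ind_le T)
  have h3 := (summable_toReal X).sub (summable_toReal Y)
  have h4 : ∑' s, ((X s).toReal - (Y s).toReal) = 0 := by
    rw [(summable_toReal X).tsum_sub (summable_toReal Y), tsum_toReal, tsum_toReal, sub_self]
  -- The differences sum to zero, so adding half of them turns half the absolute value into the
  -- positive part without changing the sum. The positive part dominates the contribution of every
  -- test.
  have h5 : ev X (ind T) - ev Y (ind T) ≤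
      ∑' s, (1 / 2 * |(X s).toReal - (Y s).toReal| + 1 / 2 * ((X s).toReal - (Y s).toReal)) := by
    rw [ev, ev, ← h1.tsum_sub h2]
    refine (h1.sub h2).tsum_le_tsum (fun s => ?_)
      (((summable_statDist X Y).mul_left _).add (h3.mul_left _))
    have := le_abs_self ((X s).toReal - (Y s).toReal)
    have := neg_le_abs ((X s).toReal - (Y s).toReal)
    by_cases hs : s ∈ T
    · rw [ind_of_mem hs]; linarith
    · rw [ind_of_notMem hs]; linarith
  rw [((summable_statDist X Y).mul_left _).tsum_add (h3.mul_left _), tsum_mul_left,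
    tsum_mul_left, h4, mul_zero, add_zero] at h5
  exact h5

theorem statDist_eq_ev_ind_sub (X Y : PMF S) :
    ∃ T : Set S, statDist X Y = ev X (ind T) - ev Y (ind T) := by
  refine ⟨{s | (Y s).toReal ≤ (X s).toReal}, ?_⟩
  set T := {s | (Y s).toReal ≤ (X s).toReal}
  have h1 := summable_ev X (abs_ind_le T)
  have h2 := summable_ev Y (abs_ind_le T)
  have h3 := (summable_toReal X).sub (summable_toReal Y)
  have h4 : ∑' s, ((X s).toReal - (Y s).toReal) = 0 := by
    rw [(summable_toReal X).tsum_sub (summable_toReal Y), tsum_toReal, tsum_toReal, sub_self]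
  have h5 : ev X (ind T) - ev Y (ind T) =
      ∑' s, (1 / 2 * |(X s).toReal - (Y s).toReal| + 1 / 2 * ((X s).toReal - (Y s).toReal)) := by
    rw [ev, ev, ← h1.tsum_sub h2]
    refine tsum_congr fun s => ?_
    by_cases hs : s ∈ T
    · rw [ind_of_mem hs, abs_of_nonneg (sub_nonneg.2 hs)]; ring
    · rw [ind_of_notMem hs, abs_of_neg (sub_neg.2 (not_le.1 hs))]; ring
  rw [h5, ((summable_statDist X Y).mul_left _).tsum_add (h3.mul_left _), tsum_mul_left,
    tsum_mul_left, h4, mul_zero, add_zero, statDist]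

end Expectation

theorem ev_unif {n : ℕ} (φ : Bits n → ℝ) : ev (unif n) φ = (∑ s, φ s) / 2 ^ n := by
  rw [ev_fintype, unif, Finset.sum_div]
  refine Finset.sum_congr rfl fun s _ => ?_
  rw [PMF.uniformOfFintype_apply]
  simp
  ring

/-- The expected difference between a test on `(S, C)` and on `(U, C)`. -/
def bias {Ω S T : Type*} (U : PMF S) (X : Ω → S) (Z : Ω → T) (A : Set (S × T)) (ω : Ω) : ℝ :=
  ind A (X ω, Z ω) - ev U fun s => ind A (s, Z ω)

section Distance

variable {Ω S T : Type*}

theorem abs_bias_le (U : PMF S) (X : Ω → S) (Z : Ω → T) (A : Set (S × T)) (ω : Ω) :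
    |bias U X Z A ω| ≤ 2 := by
  have h1 := abs_ev_le U fun s => abs_ind_le A (s, Z ω)
  have h2 := abs_ind_le A (X ω, Z ω)
  exact (abs_sub _ _).trans (by linarith)

/-- This rewrites the advantage of a test as an expectation over the original probability space,
where conditioning and fixing of coordinates are linear operations. -/
theorem ev_test_sub (P : PMF Ω) (X : Ω → S) (U : PMF S) (Z : Ω → T) (A : Set (S × T)) :
    ev (P.map fun ω => (X ω, Z ω)) (ind A) - ev (indep U (P.map Z)) (ind A) =
      ev P (bias U X Z A) := by
  rw [ev_map P _ (abs_ind_le A), ev_indep_swap _ _ (abs_ind_le A),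
    ev_map P _ fun t => abs_ev_le U fun s => abs_ind_le A (s, t),
    ← ev_sub P (fun ω => abs_ind_le A (X ω, Z ω))
      (fun ω => abs_ev_le U fun s => abs_ind_le A (s, Z ω))]
  rfl

theorem ev_bias_le_distGiven (P : PMF Ω) (X : Ω → S) (U : PMF S) (Z : Ω → T)
    (A : Set (S × T)) : ev P (bias U X Z A) ≤ distGiven P X U Z := by
  rw [← ev_test_sub]
  exact ev_ind_sub_le_statDist _ _ A

theorem distGiven_le (P : PMF Ω) (X : Ω → S) (U : PMF S) (Z : Ω → T) {η : ℝ}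
    (h : ∀ A, ev P (bias U X Z A) ≤ η) : distGiven P X U Z ≤ η := by
  obtain ⟨A, hA⟩ := statDist_eq_ev_ind_sub (P.map fun ω => (X ω, Z ω)) (indep U (P.map Z))
  rw [distGiven, hA, ev_test_sub]
  exact h A

end Distance

/-! ### Random functions as seeded extractors -/

section SeededExtractor

variable {W D O : Type*} [Fintype W] [Fintype D] [Fintype O]

/-- The total bias of a test `T` on the graph of `g`. -/
def deviation (T : Set (D × O)) (g : D → O) : ℝ :=
  ∑ σ, (ind T (σ, g σ) - (∑ o, ind T (σ, o)) / Fintype.card O)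

theorem deviation_le (T : Set (D × O)) (g : D → O) : deviation T g ≤ Fintype.card D := by
  have h : ∀ σ ∈ (Finset.univ : Finset D),
      ind T (σ, g σ) - (∑ o, ind T (σ, o)) / Fintype.card O ≤ 1 := by
    intro σ _
    have h1 : 0 ≤ (∑ o, ind T (σ, o)) / Fintype.card O :=
      div_nonneg (Finset.sum_nonneg fun o _ => ind_nonneg T _) (Nat.cast_nonneg _)
    linarith [ind_le_one T (σ, g σ)]
  have h2 := Finset.sum_le_card_nsmul _ _ _ h
  rwa [Finset.card_univ, nsmul_eq_mul, mul_one] at h2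

/-- In the second-order bound for the exponential the linear term cancels, because the indicator is
centred at its mean. -/
theorem sum_exp_ind_le [Nonempty O] (T : Set O) {t : ℝ} (ht0 : 0 ≤ t) (ht1 : t ≤ 1) :
    ∑ o, Real.exp (t * (ind T o - (∑ o', ind T o') / Fintype.card O)) ≤
      Fintype.card O * Real.exp (t ^ 2) := by
  set p : ℝ := (∑ o', ind T o') / Fintype.card O with hp
  have hc : (0 : ℝ) < Fintype.card O := by exact_mod_cast Fintype.card_pos
  have hp0 : 0 ≤ p := div_nonneg (Finset.sum_nonneg fun o _ => ind_nonneg T _) hc.le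
  have hp1 : p ≤ 1 := by
    rw [hp, div_le_one hc]
    simpa using Finset.sum_le_card_nsmul Finset.univ (ind T) 1 fun o _ => ind_le_one T o
  have hx : ∀ o, |ind T o - p| ≤ 1 := fun o =>
    abs_le.2 ⟨by linarith [ind_nonneg T o], by linarith [ind_le_one T o]⟩
  have hb : ∀ o, Real.exp (t * (ind T o - p)) ≤ 1 + t * (ind T o - p) + t ^ 2 := by
    intro o
    have h1 : |t * (ind T o - p)| ≤ 1 := by
      rw [abs_mul, abs_of_nonneg ht0]
      exact mul_le_one₀ ht1 (abs_nonneg _) (hx o)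
    have h2 := (abs_le.1 (Real.abs_exp_sub_one_sub_id_le h1)).2
    have h3 : (t * (ind T o - p)) ^ 2 ≤ t ^ 2 := by
      rw [mul_pow]
      exact mul_le_of_le_one_right (sq_nonneg t) ((sq_le_one_iff_abs_le_one _).2 (hx o))
    linarith
  calc _ ≤ ∑ o, (1 + t * (ind T o - p) + t ^ 2) := Finset.sum_le_sum fun o _ => hb o
    _ = Fintype.card O * (1 + t ^ 2) := by
      have h4 : ∑ o, ind T o = p * Fintype.card O := by rw [hp]; field_simp
      rw [Finset.sum_add_distrib, Finset.sum_add_distrib, ← Finset.mul_sum,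
        Finset.sum_sub_distrib, h4]
      simp
      ring
    _ ≤ _ := mul_le_mul_of_nonneg_left (by linarith [Real.add_one_le_exp (t ^ 2)]) hc.le

open Classical in
-- Chernoff's bound: under a uniformly random `g` the summands of the deviation are independent and
-- centred. The parameter `t = θ / 2` minimises `t ^ 2 - t * θ`.
theorem card_deviation_lt [Nonempty O] (T : Set (D × O)) {θ : ℝ} (hθ0 : 0 ≤ θ) (hθ1 : θ ≤ 1) :
    ((Finset.univ.filter fun g : D → O => θ * Fintype.card D < deviation T g).card : ℝ) ≤
      Fintype.card (D → O) * Real.exp (-(θ ^ 2 * Fintype.card D / 4)) := by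
  set t := θ / 2 with ht
  have h1 : ∀ g : D → O, (if θ * Fintype.card D < deviation T g then (1 : ℝ) else 0) ≤
      Real.exp (-(t * θ * Fintype.card D)) *
        ∏ σ, Real.exp (t * (ind T (σ, g σ) - (∑ o, ind T (σ, o)) / Fintype.card O)) := by
    intro g
    rw [← Real.exp_sum, ← Finset.mul_sum, ← Real.exp_add]
    split_ifs with h
    · apply Real.one_le_exp
      have : 0 ≤ t * (deviation T g - θ * Fintype.card D) :=
        mul_nonneg (by positivity) (by linarith)
      unfold deviation at this
      linarith
    · positivity
  have h2 : ∑ g : D → O, ∏ σ, Real.exp (t * (ind T (σ, g σ) -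
      (∑ o, ind T (σ, o)) / Fintype.card O)) =
      ∏ σ, ∑ o, Real.exp (t * (ind T (σ, o) - (∑ o, ind T (σ, o)) / Fintype.card O)) := by
    rw [Finset.prod_univ_sum]
    simp
  have h3 : ∏ σ : D, ∑ o, Real.exp (t * (ind T (σ, o) -
      (∑ o, ind T (σ, o)) / Fintype.card O)) ≤
      ∏ _σ : D, (Fintype.card O * Real.exp (t ^ 2) : ℝ) := by
    refine Finset.prod_le_prod (fun σ _ => Finset.sum_nonneg fun o _ => (Real.exp_pos _).le)
      fun σ _ => ?_
    exact sum_exp_ind_le {o | (σ, o) ∈ T} (by positivity) (by linarith)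
  calc _ = ∑ g : D → O, (if θ * Fintype.card D < deviation T g then (1 : ℝ) else 0) := by
        rw [Finset.sum_boole]
    _ ≤ _ := Finset.sum_le_sum fun g _ => h1 g
    _ ≤ Real.exp (-(t * θ * Fintype.card D)) *
        ∏ _σ : D, (Fintype.card O * Real.exp (t ^ 2) : ℝ) := by
        rw [← Finset.mul_sum, h2]
        exact mul_le_mul_of_nonneg_left h3 (Real.exp_pos _).le
    _ = _ := by
        rw [Finset.prod_const, Finset.card_univ, mul_pow, ← Real.exp_nat_mul, Fintype.card_fun,
          Nat.cast_pow, mul_left_comm, ← Real.exp_add, ht]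
        congr 2
        ring

open Classical in
/-- A random function is a seeded extractor: every test has a noticeable bias for few inputs
only. -/
theorem exists_seededExtractor [Nonempty O] {θ : ℝ} (hθ0 : 0 ≤ θ) (hθ1 : θ ≤ 1)
    (h : Fintype.card W * Real.exp (-(θ ^ 2 * Fintype.card D / 4)) ≤ 1) :
    ∃ e : W → D → O, ∀ T : Set (D × O),
      (Finset.univ.filter fun w => θ * Fintype.card D < deviation T (e w)).card ≤
        Fintype.card D * Fintype.card O + 2 := by
  set bad : Set (D × O) → (D → O) → Prop := fun T g => θ * Fintype.card D < deviation T g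
  have hG : (0 : ℝ) < Fintype.card (D → O) := by exact_mod_cast Fintype.card_pos
  set q := Real.exp (-(θ ^ 2 * Fintype.card D / 4)) with hq
  -- The exponential moment of the number of bad inputs factorises over `w`, giving `(1 + q) ^ |W| ≤
  -- exp (|W| * q) ≤ exp 1 ≤ 4`.
  have h1 : ∀ T, ∑ e : W → D → O, (2 : ℝ) ^ (Finset.univ.filter fun w => bad T (e w)).card ≤
      Fintype.card (W → D → O) * 4 := by
    intro T
    have h2 : ∀ e : W → D → O, (2 : ℝ) ^ (Finset.univ.filter fun w => bad T (e w)).card =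
        ∏ w, (1 + if bad T (e w) then (1 : ℝ) else 0) := by
      intro e
      rw [← Finset.prod_const, Finset.prod_filter]
      refine Finset.prod_congr rfl fun w _ => ?_
      split_ifs <;> norm_num
    have h3 : ∑ e : W → D → O, ∏ w, (1 + if bad T (e w) then (1 : ℝ) else 0) =
        ∏ _w : W, ∑ g : D → O, (1 + if bad T g then (1 : ℝ) else 0) := by
      rw [Finset.prod_univ_sum]
      simp
    have h4 : ∑ g : D → O, (1 + if bad T g then (1 : ℝ) else 0) ≤
        Fintype.card (D → O) * Real.exp q := by
      have := card_deviation_lt T hθ0 hθ1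
      rw [Finset.sum_add_distrib, Finset.sum_boole]
      simp only [Finset.sum_const, Finset.card_univ, nsmul_eq_mul, mul_one]
      calc _ ≤ (Fintype.card (D → O) : ℝ) + Fintype.card (D → O) * q := by
            gcongr
        _ = Fintype.card (D → O) * (q + 1) := by ring
        _ ≤ _ := mul_le_mul_of_nonneg_left (Real.add_one_le_exp q) hG.le
    simp only [h2]
    rw [h3, Finset.prod_const, Finset.card_univ, Fintype.card_fun (α := W), Nat.cast_pow]
    calc _ ≤ (Fintype.card (D → O) * Real.exp q) ^ Fintype.card W :=
          pow_le_pow_left₀ (Finset.sum_nonneg fun g _ => by split_ifs <;> norm_num) h4 _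
      _ = Fintype.card (D → O) ^ Fintype.card W * Real.exp (Fintype.card W * q) := by
          rw [mul_pow, ← Real.exp_nat_mul]
      _ ≤ _ := by
          refine mul_le_mul_of_nonneg_left ?_ (by positivity)
          calc _ ≤ Real.exp 1 := Real.exp_le_exp.2 h
            _ ≤ 4 := by linarith [Real.exp_one_lt_d9]
  -- Summing over all `2 ^ (|D| * |O|)` tests before averaging yields one `e` that is good for every
  -- test at once; the logarithm of this count and of the factor 4 is the final bound.
  have h5 : ∑ e : W → D → O, ∑ T : Set (D × O),
      (2 : ℝ) ^ (Finset.univ.filter fun w => bad T (e w)).card ≤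
      ∑ _e : W → D → O, (4 * 2 ^ (Fintype.card D * Fintype.card O) : ℝ) := by
    rw [Finset.sum_comm]
    calc _ ≤ ∑ _T : Set (D × O), (Fintype.card (W → D → O) * 4 : ℝ) :=
          Finset.sum_le_sum fun T _ => h1 T
      _ = _ := by
          simp only [Finset.sum_const, Finset.card_univ, nsmul_eq_mul, Fintype.card_set,
            Fintype.card_prod, Nat.cast_pow, Nat.cast_ofNat]
          ring
  obtain ⟨e, -, he⟩ := Finset.exists_le_of_sum_le Finset.univ_nonempty h5
  refine ⟨e, fun T => ?_⟩
  have h6 := (Finset.single_le_sum (f := fun T =>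
    (2 : ℝ) ^ (Finset.univ.filter fun w => bad T (e w)).card)
    (fun T _ => by positivity) (Finset.mem_univ T)).trans he
  have h7 : (4 * 2 ^ (Fintype.card D * Fintype.card O) : ℝ) =
      2 ^ (Fintype.card D * Fintype.card O + 2) := by ring
  rw [h7] at h6
  exact (pow_le_pow_iff_right₀ (by norm_num : (1 : ℝ) < 2)).1 h6

open Classical in
/-- A seeded extractor fools tests that depend on a leakage `leak w` about the input. -/
theorem sum_deviation_le {Λ : Type*} [Fintype Λ] {e : W → D → O} {θ N : ℝ}
    (he : ∀ T : Set (D × O),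
      ((Finset.univ.filter fun w => θ * Fintype.card D < deviation T (e w)).card : ℝ) ≤ N)
    {p : W → ℝ} {b : ℝ} (hp0 : ∀ w, 0 ≤ p w) (hp1 : ∑ w, p w = 1) (hpb : ∀ w, p w ≤ b)
    (hθ : 0 ≤ θ) (leak : W → Λ) (T : Λ → Set (D × O)) :
    ∑ w, p w * deviation (T (leak w)) (e w) ≤
      (θ + Fintype.card Λ * (b * N)) * Fintype.card D := by
  -- An input that is bad for its own leakage value is charged to the sum over all values `a`. This
  -- removes the dependence of the test on `w`, and each fixed test has at most `N` bad inputs, of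
  -- weight at most `b`.
  have h1 : ∀ w, p w * deviation (T (leak w)) (e w) ≤ p w * (θ * Fintype.card D) +
      ∑ a, if θ * Fintype.card D < deviation (T a) (e w) then b * Fintype.card D else 0 := by
    intro w
    have hb : 0 ≤ b := (hp0 w).trans (hpb w)
    by_cases h : θ * Fintype.card D < deviation (T (leak w)) (e w)
    · have h2 := Finset.single_le_sum (f := fun a =>
        if θ * Fintype.card D < deviation (T a) (e w) then b * (Fintype.card D : ℝ) else 0)
        (fun a _ => by split_ifs <;> positivity) (Finset.mem_univ (leak w))
      simp only [h, if_true] at h2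
      have h3 : p w * deviation (T (leak w)) (e w) ≤ b * Fintype.card D :=
        mul_le_mul (hpb w) (deviation_le _ _) ((by positivity : (0:ℝ) ≤ _).trans h.le) hb
      have h4 : 0 ≤ p w * (θ * Fintype.card D) :=
        mul_nonneg (hp0 w) (by positivity)
      linarith
    · have h2 : 0 ≤ ∑ a, if θ * Fintype.card D < deviation (T a) (e w) then
          b * (Fintype.card D : ℝ) else 0 :=
        Finset.sum_nonneg fun a _ => by split_ifs <;> positivity
      have h3 := mul_le_mul_of_nonneg_left (not_lt.1 h) (hp0 w)
      linarith
  have hW : Nonempty W := by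
    by_contra hW
    rw [not_nonempty_iff] at hW
    simp at hp1
  have hb : 0 ≤ b := (hp0 hW.some).trans (hpb hW.some)
  calc _ ≤ _ := Finset.sum_le_sum fun w _ => h1 w
    _ = θ * Fintype.card D + ∑ a, (Finset.univ.filter fun w =>
          θ * Fintype.card D < deviation (T a) (e w)).card * (b * Fintype.card D) := by
        rw [Finset.sum_add_distrib, ← Finset.sum_mul, hp1, one_mul, Finset.sum_comm]
        simp only [← Finset.sum_filter, Finset.sum_const, nsmul_eq_mul]
    _ ≤ θ * Fintype.card D + ∑ _a : Λ, N * (b * Fintype.card D) := by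
        gcongr with a
        exact he (T a)
    _ = _ := by
        simp only [Finset.sum_const, Finset.card_univ, nsmul_eq_mul]
        ring

end SeededExtractor

/-! ### The polynomial hash -/

section Hash

open Polynomial

/-- A polynomial hash of a bit string. -/
def polyHash {F : Type*} [Field F] {d : ℕ} (x : F) (a : Bits d) : F :=
  ∑ i : Fin d, (if a i then 1 else 0) * x ^ (i.val + 1)

open Classical in
-- The solutions are roots of a nonzero polynomial of degree at most `d`. The hash has exponents
-- starting at 1, so `t` enters the constant coefficient only and cannot cancel the coefficient
-- where `a` and `b` differ.
theorem card_polyHash_sub_eq {F : Type*} [Field F] [Fintype F] {d : ℕ} {a b : Bits d}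
    (hab : a ≠ b) (t : F) :
    (Finset.univ.filter fun x : F => polyHash x a - polyHash x b = t).card ≤ d := by
  set c : Fin d → F := fun i => (if a i then 1 else 0) - if b i then 1 else 0 with hc
  set p : F[X] := ∑ i : Fin d, C (c i) * X ^ (i.val + 1) - C t with hp
  obtain ⟨j, hj⟩ := Function.ne_iff.1 hab
  have hcj : c j ≠ 0 := by
    rw [hc]
    cases h1 : a j <;> cases h2 : b j <;> simp_all
  have hcoeff : p.coeff (j.val + 1) = c j := by
    rw [hp, coeff_sub, coeff_C_succ, sub_zero, finsetSum_coeff,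
      Finset.sum_eq_single j]
    · rw [coeff_C_mul_X_pow, if_pos rfl]
    · intro i _ hij
      rw [coeff_C_mul_X_pow, if_neg]
      intro h
      exact hij (Fin.ext (by omega))
    · simp
  have hp0 : p ≠ 0 := by
    intro h
    rw [h, coeff_zero] at hcoeff
    exact hcj hcoeff.symm
  have hdeg : p.natDegree ≤ d := by
    refine (natDegree_sub_le _ _).trans (max_le ?_ (by simp))
    refine natDegree_sum_le_of_forall_le _ _ fun i _ => ?_
    exact (natDegree_C_mul_X_pow_le _ _).trans (by omega)
  calc _ ≤ p.roots.toFinset.card := by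
        refine Finset.card_le_card fun x hx => ?_
        rw [Finset.mem_filter] at hx
        rw [Multiset.mem_toFinset, mem_roots hp0, IsRoot, hp, eval_sub, eval_C, sub_eq_zero,
          eval_finsetSum, ← hx.2, polyHash, polyHash, ← Finset.sum_sub_distrib]
        refine Finset.sum_congr rfl fun i _ => ?_
        simp only [eval_mul, eval_C, eval_pow, eval_X, hc]
        ring
    _ ≤ _ := (Multiset.toFinset_card_le _).trans ((card_roots' p).trans hdeg)

end Hash

theorem ev_congr {Ω : Type*} (P : PMF Ω) {φ ψ : Ω → ℝ} (h : ∀ ω, φ ω = ψ ω) :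
    ev P φ = ev P ψ := by rw [funext h]

theorem ev_sum {Ω ι : Type*} (P : PMF Ω) (s : Finset ι) {φ : ι → Ω → ℝ} {M : ℝ}
    (hφ : ∀ i ω, |φ i ω| ≤ M) : ev P (fun ω => ∑ i ∈ s, φ i ω) = ∑ i ∈ s, ev P (φ i) := by
  simp only [ev, Finset.mul_sum]
  exact Summable.tsum_finsetSum fun i _ => summable_ev P (hφ i)

theorem ev_ind_singleton {Ω : Type*} (P : PMF Ω) (a : Ω) : ev P (ind {a}) = (P a).toReal := by
  rw [ev, tsum_eq_single a, ind_of_mem (Set.mem_singleton a), mul_one]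
  intro b hb
  rw [ind_of_notMem (T := {a}) hb, mul_zero]

theorem ev_uniformOfFinset {S : Type*} (Z : Finset S) (hZ : Z.Nonempty) (φ : S → ℝ) :
    ev (PMF.uniformOfFinset Z hZ) φ = (∑ z ∈ Z, φ z) / Z.card := by
  rw [ev, tsum_eq_sum (s := Z), Finset.sum_div]
  · refine Finset.sum_congr rfl fun z hz => ?_
    rw [PMF.uniformOfFinset_apply_of_mem _ hz]
    simp
    ring
  · intro z hz
    rw [PMF.uniformOfFinset_apply_of_notMem _ hz]
    simp

theorem exists_fixedPointFree {n : ℕ} (hn : 0 < n) : ∃ f : Bits n → Bits n, FixedPointFree f :=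
  ⟨fun x i => !x i, fun x h => by simpa using congrFun h ⟨0, hn⟩⟩

/-! ### Conditioned and flat sources -/

section Sources

variable {n : ℕ} {k : ℝ}

theorem isSource_filter {W : PMF (Bits n)} (hW : IsSource k W) (V : Set (Bits n))
    (hV : ∃ w ∈ V, w ∈ W.support) {s : ℝ} (hs : (2 : ℝ) ^ (-s) ≤ ev W (ind V)) :
    IsSource (k - s) (W.filter V hV) := by
  rw [isSource_iff] at hW ⊢
  intro x
  have hpos := ev_ind_pos W V hV
  rw [← ev_ind_singleton, ev_filter, div_le_iff₀ hpos]
  calc ev W (fun ω => ind V ω * ind {x} ω) ≤ ev W (ind {x}) := by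
        refine ev_mono W (M := 1) (M' := 1) (fun ω => ?_) (abs_ind_le _) fun ω =>
          mul_le_of_le_one_left (ind_nonneg _ _) (ind_le_one _ _)
        rw [abs_mul]
        exact mul_le_one₀ (abs_ind_le _ _) (abs_nonneg _) (abs_ind_le _ _)
    _ ≤ (2 : ℝ) ^ (-k) := by rw [ev_ind_singleton]; exact hW x
    _ = (2 : ℝ) ^ (-(k - s)) * (2 : ℝ) ^ (-s) := by
        rw [← Real.rpow_add two_pos]; congr 1; ring
    _ ≤ _ := mul_le_mul_of_nonneg_left hs (by positivity)

theorem isSource_map_uniformOfFinset {U : Type*} (Z : Finset U) (hZ : Z.Nonempty)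
    (hk : (2 : ℝ) ^ k ≤ Z.card) {y : U → Bits n} (hy : Function.Injective y) :
    IsSource k ((PMF.uniformOfFinset Z hZ).map y) := by
  classical
  rw [isSource_iff]
  intro b
  rw [← ev_ind_singleton, ev_map _ _ (abs_ind_le _), ev_uniformOfFinset, Real.rpow_neg two_pos.le,
    ← one_div]
  have h1 : ∑ z ∈ Z, ind {b} (y z) ≤ 1 := by
    by_cases h : ∃ z, y z = b
    · obtain ⟨z, rfl⟩ := h
      calc _ ≤ ∑ z' ∈ Z, (if z' = z then (1 : ℝ) else 0) := by
            refine Finset.sum_le_sum fun z' _ => ?_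
            split_ifs with h
            · exact ind_le_one _ _
            · rw [ind_of_notMem (T := {y z}) fun h' => h (hy h')]
        _ ≤ 1 := by
            rw [Finset.sum_ite_eq']
            split_ifs <;> norm_num
    · rw [Finset.sum_eq_zero]
      · norm_num
      · intro z _
        exact ind_of_notMem fun h' => h ⟨z, h'⟩
  have h2 : (0 : ℝ) < Z.card := by exact_mod_cast hZ.card_pos
  exact div_le_div₀ zero_le_one h1 (by positivity) hk

end Sources

/-! ### Non-malleability under leakage and tampering -/

section NonMalleable

variable {n₁ n₂ m : ℕ} {E : Bits n₁ → Bits n₂ → Bits m} {U : Type*}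

open Classical in
/-- Non-malleability on a pair of events of noticeable probability. -/
theorem sum_ev_test_le (hn₁ : 0 < n₁) (hn₂ : 0 < n₂) {W : PMF (Bits n₁)} {k s k₂ ε τ : ℝ}
    (hW : IsSource k W) (hE : NonMalleableGiven (k - s) k₂ ε E fun p => p.2)
    (V : Set (Bits n₁)) (hV : (2 : ℝ) ^ (-s) ≤ ev W (ind V))
    (Z : Finset U) (hZ : (2 : ℝ) ^ k₂ ≤ Z.card)
    {y y' : U → Bits n₂} (hy : Function.Injective y) {f : Bits n₁ → Bits n₁}
    (hf : (∀ w ∈ V, f w ≠ w) ∨ ∀ z ∈ Z, y' z ≠ y z)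
    (T : U → Bits m → Set (Bits m)) (hτ : 0 ≤ τ) (hT : ∀ z e, ev (unif m) (ind (T z e)) ≤ τ) :
    ∑ z ∈ Z, ev W (fun w => ind V w * ind (T z (E (f w) (y' z))) (E w (y z))) ≤
      ev W (ind V) * (Z.card * (ε + τ)) := by
  have hVpos : 0 < ev W (ind V) := lt_of_lt_of_le (by positivity) hV
  have hZpos : (0 : ℝ) < Z.card := lt_of_lt_of_le (by positivity) hZ
  have hVs : ∃ w ∈ V, w ∈ W.support := by
    by_contra! h
    refine hVpos.ne' ?_
    refine (tsum_congr fun w => ?_).trans tsum_zero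
    by_cases hw : w ∈ V
    · rw [(PMF.apply_eq_zero_iff W w).2 (h w hw), ENNReal.toReal_zero, zero_mul]
    · rw [ind_of_notMem hw, mul_zero]
  have hZne : Z.Nonempty := Finset.card_pos.1 (by exact_mod_cast hZpos)
  obtain ⟨f₀, hf₀⟩ := exists_fixedPointFree hn₁
  obtain ⟨g₀, hg₀⟩ := exists_fixedPointFree hn₂
  -- The definition requires tampering without fixed points everywhere, but this is known only on
  -- `V` or on `Z`. Off these sets the maps are replaced by fixed-point-free ones, which the
  -- conditioned sources never see.
  set f' : Bits n₁ → Bits n₁ := fun w => if w ∈ V then f w else f₀ w with hf'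
  set g' : Bits n₂ → Bits n₂ := fun b =>
    if h : ∃ z ∈ Z, y z = b then y' h.choose else g₀ b with hg'
  have hg'y : ∀ z ∈ Z, g' (y z) = y' z := by
    intro z hz
    have h : ∃ z' ∈ Z, y z' = y z := ⟨z, hz, rfl⟩
    rw [hg']
    simp only [h, dif_pos]
    rw [hy h.choose_spec.2]
  have hff : FixedPointFree f' ∨ FixedPointFree g' := by
    rcases hf with hf | hf
    · left
      intro w
      rw [hf']
      by_cases hw : w ∈ V
      · simpa [hw] using hf w hw
      · simpa [hw] using hf₀ w
    · right
      intro b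
      by_cases h : ∃ z ∈ Z, y z = b
      · obtain ⟨z, hz, rfl⟩ := h
        rw [hg'y z hz]
        exact hf z hz
      · rw [hg']
        simpa only [h, dif_neg, not_false_eq_true] using hg₀ b
  set X := W.filter V hVs with hX
  set Y := (PMF.uniformOfFinset Z hZne).map y with hY
  -- The test may depend on `z` because right strongness reveals the second source, and `y` is
  -- injective.
  set A : Set (Bits m × Bits m × Bits n₂) := {t | ∃ z ∈ Z, y z = t.2.2 ∧ t.1 ∈ T z t.2.1} with hA
  have hAy : ∀ z ∈ Z, ∀ e e', ind A (e, e', y z) = ind (T z e') e := by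
    intro z hz e e'
    by_cases h : e ∈ T z e'
    · rw [ind_of_mem h, ind_of_mem (T := A) ⟨z, hz, rfl, h⟩]
    · rw [ind_of_notMem h, ind_of_notMem]
      rintro ⟨z', _, h1, h2⟩
      rw [hy h1] at h2
      exact h h2
  have hAτ : ∀ e' b, ev (unif m) (fun e => ind A (e, e', b)) ≤ τ := by
    intro e' b
    by_cases h : ∃ z ∈ Z, y z = b
    · obtain ⟨z, hz, rfl⟩ := h
      rw [ev_congr _ fun e => hAy z hz e e']
      exact hT z e'
    · refine ev_le _ (fun e => abs_ind_le A (e, e', b)) fun e => ?_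
      rw [ind_of_notMem]
      · exact hτ
      · rintro ⟨z, hz, h1, _⟩
        exact h ⟨z, hz, h1⟩
  have h1 := (ev_bias_le_distGiven (indep X Y) (fun p => E p.1 p.2) (unif m)
    (fun p => (E (f' p.1) (g' p.2), p.2)) A).trans
      (hE X Y (isSource_filter hW V hVs hV) (isSource_map_uniformOfFinset Z hZne hZ hy) f' g' hff)
  have h2 : ev (indep X Y) (fun p => ind A (E p.1 p.2, E (f' p.1) (g' p.2), p.2)) ≤ ε + τ := by
    have h3 : ev (indep X Y) (fun p => ev (unif m) fun e =>
        ind A (e, E (f' p.1) (g' p.2), p.2)) ≤ τ :=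
      ev_le _ (fun p => abs_ev_le _ fun e => abs_ind_le A _) fun p => hAτ _ _
    unfold bias at h1
    rw [ev_sub _ (fun p => abs_ind_le A _) (fun p => abs_ev_le _ fun e => abs_ind_le A _)] at h1
    linarith
  rw [ev_indep_swap _ _ (fun p => abs_ind_le A _), hY,
    ev_map _ _ (fun b => abs_ev_le X fun x => abs_ind_le A (E x b, E (f' x) (g' b), b)),
    ev_uniformOfFinset, div_le_iff₀ hZpos] at h2
  have h3 : ∀ z ∈ Z, ev X (fun w => ind A (E w (y z), E (f' w) (g' (y z)), y z)) =
      ev W (fun w => ind V w * ind (T z (E (f w) (y' z))) (E w (y z))) / ev W (ind V) := by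
    intro z hz
    rw [hX, ev_filter]
    congr 1
    refine ev_congr _ fun w => ?_
    by_cases hw : w ∈ V
    · rw [hAy z hz, hg'y z hz, hf']
      simp only [hw, if_true]
    · rw [ind_of_notMem hw, zero_mul, zero_mul]
  rw [Finset.sum_congr rfl h3, ← Finset.sum_div, div_le_iff₀ hVpos] at h2
  linarith

theorem abs_ind_mul_ind_le {Ω : Type*} (V T : Set Ω) (ω : Ω) : |ind V ω * ind T ω| ≤ 1 := by
  rw [abs_mul]
  exact mul_le_one₀ (abs_ind_le _ _) (abs_nonneg _) (abs_ind_le _ _)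

theorem ev_ind_mul_ind_le {Ω : Type*} (P : PMF Ω) (V T : Set Ω) :
    ev P (fun ω => ind V ω * ind T ω) ≤ ev P (ind V) :=
  ev_mono P (abs_ind_mul_ind_le V T) (abs_ind_le V) fun _ =>
    mul_le_of_le_one_right (ind_nonneg _ _) (ind_le_one _ _)

open Classical in
/-- The derived keys `E (w, y)` and `E (f w, y')` of two parties are tested. If the inputs agree,
then the key of the honest party has to pass a test `T₁`, and otherwise it has to pass a test `T₂`
that depends on the other key. Both tests may depend on leakage about `w`. -/
theorem sum_ev_bad_le [Fintype U] {Λ : Type*} [Fintype Λ] (hn₁ : 0 < n₁) (hn₂ : 0 < n₂)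
    {W : PMF (Bits n₁)} {k s k₂ ε τ : ℝ}
    (hW : IsSource k W) (hE : NonMalleableGiven (k - s) k₂ ε E fun p => p.2)
    (leak : Bits n₁ → Λ) (f : Bits n₁ → Bits n₁) {y : Λ → U → Bits n₂} (y' : Λ → U → Bits n₂)
    (hy : ∀ a, Function.Injective (y a)) (bad : U → Set (Bits n₁))
    (T₁ : Λ → U → Set (Bits m)) (T₂ : Λ → U → Bits m → Set (Bits m)) (hε : 0 ≤ ε) (hτ : 0 ≤ τ)
    (hT₁ : ∀ a z, ev (unif m) (ind (T₁ a z)) ≤ τ)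
    (hT₂ : ∀ a z e, ev (unif m) (ind (T₂ a z e)) ≤ τ)
    (hbad₁ : ∀ w z, w ∈ bad z → f w = w → y' (leak w) z = y (leak w) z →
      E w (y (leak w) z) ∈ T₁ (leak w) z)
    (hbad₂ : ∀ w z, w ∈ bad z → (f w ≠ w ∨ y' (leak w) z ≠ y (leak w) z) →
      E w (y (leak w) z) ∈ T₂ (leak w) z (E (f w) (y' (leak w) z))) :
    ∑ z, ev W (ind (bad z)) ≤ 2 * Fintype.card Λ * (2 : ℝ) ^ (-s) * Fintype.card U +
      (Fintype.card U * (ε + τ) + 2 * (2 : ℝ) ^ k₂) := by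
  obtain ⟨f₀, hf₀⟩ := exists_fixedPointFree hn₁
  -- Each cell fixes the leakage and whether the secret is unchanged. Splitting the honest first
  -- parts in the same way by `y' = y` leaves blocks on which agreement of the inputs is constant.
  set V : Λ × Bool → Set (Bits n₁) := fun c => {w | leak w = c.1 ∧ decide (f w = w) = c.2} with hV
  set Z : Λ → Bool → Finset U := fun a β => Finset.univ.filter fun z =>
    decide (y' a z = y a z) = β with hZ
  have hVsum : ∀ w, ∑ c, ind (V c) w = 1 := by
    intro w
    rw [Finset.sum_eq_single (leak w, decide (f w = w))]
    · exact ind_of_mem ⟨rfl, rfl⟩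
    · intro c _ hc
      refine ind_of_notMem ?_
      rintro ⟨h1, h2⟩
      exact hc (Prod.ext h1.symm h2.symm)
    · simp
  have hpart : ∀ (c : Λ × Bool) (β : Bool), (2 : ℝ) ^ (-s) ≤ ev W (ind (V c)) →
      ∑ z ∈ Z c.1 β, ev W (fun w => ind (V c) w * ind (bad z) w) ≤
        ev W (ind (V c)) * ((Z c.1 β).card * (ε + τ) + (2 : ℝ) ^ k₂) := by
    intro c β hc
    have hQ : 0 ≤ ev W (ind (V c)) := ev_nonneg _ (ind_nonneg _)
    have h2 : (0 : ℝ) < 2 ^ k₂ := by positivity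
    -- A class with fewer than `2 ^ k₂` elements is too small for a source and is simply discarded.
    -- There are two classes, whence the term `2 * 2 ^ k₂`.
    rcases lt_or_ge ((Z c.1 β).card : ℝ) ((2 : ℝ) ^ k₂) with h | h
    · calc _ ≤ ∑ z ∈ Z c.1 β, ev W (ind (V c)) :=
            Finset.sum_le_sum fun z _ => ev_ind_mul_ind_le _ _ _
        _ = ev W (ind (V c)) * (Z c.1 β).card := by rw [Finset.sum_const, nsmul_eq_mul, mul_comm]
        _ ≤ _ := by
            refine mul_le_mul_of_nonneg_left ?_ hQ
            have : 0 ≤ ((Z c.1 β).card : ℝ) * (ε + τ) := by positivity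
            linarith
    · have hkey : ∑ z ∈ Z c.1 β, ev W (fun w => ind (V c) w * ind (bad z) w) ≤
          ev W (ind (V c)) * ((Z c.1 β).card * (ε + τ)) := by
        have mono : ∀ (g : U → Bits n₁ → ℝ), (∀ z w, |g z w| ≤ 1) → (∀ z w, 0 ≤ g z w) →
            (∀ z ∈ Z c.1 β, ∀ w ∈ V c, w ∈ bad z → g z w = 1) →
            ∑ z ∈ Z c.1 β, ev W (fun w => ind (V c) w * ind (bad z) w) ≤
              ∑ z ∈ Z c.1 β, ev W fun w => ind (V c) w * g z w := by
          intro g hg hg0 h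
          refine Finset.sum_le_sum fun z hz => ev_mono W (abs_ind_mul_ind_le _ _) (M' := 1)
            (fun w => ?_) fun w => ?_
          · rw [abs_mul]
            exact mul_le_one₀ (abs_ind_le _ _) (abs_nonneg _) (hg z w)
          · by_cases hw : w ∈ V c
            · refine mul_le_mul_of_nonneg_left ?_ (ind_nonneg _ _)
              by_cases hb : w ∈ bad z
              · rw [h z hz w hw hb]
                exact ind_le_one _ _
              · rw [ind_of_notMem hb]
                exact hg0 z w
            · rw [ind_of_notMem hw, zero_mul, zero_mul]
        -- If the inputs agree, only uniformity of the key is needed, so non-malleability is applied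
        -- with an unrelated fixed-point-free `f₀` and a test that ignores the tampered key.
        by_cases hc1 : c.2 = true ∧ β = true
        · refine (mono (fun z => fun w => ind (T₁ c.1 z) (E w (y c.1 z))) (fun z w => abs_ind_le _ _)
            (fun z w => ind_nonneg _ _) ?_).trans (sum_ev_test_le hn₁ hn₂ hW hE (V c) hc (Z c.1 β)
              h (hy c.1) (y' := y c.1) (f := f₀) (Or.inl fun w _ => hf₀ w)
              (fun z _ => T₁ c.1 z) hτ fun z _ => hT₁ c.1 z)
          intro z hz w hw hb
          simp only [hZ, Finset.mem_filter, Finset.mem_univ, true_and, hc1.2,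
            decide_eq_true_eq] at hz
          obtain ⟨h1, h2⟩ := hw
          rw [hc1.1, decide_eq_true_eq] at h2
          refine ind_of_mem ?_
          rw [← h1] at hz ⊢
          exact hbad₁ w z hb h2 hz
        · have hdiff : ∀ z ∈ Z c.1 β, ∀ w ∈ V c, f w ≠ w ∨ y' c.1 z ≠ y c.1 z := by
            intro z hz w hw
            simp only [hZ, Finset.mem_filter, Finset.mem_univ, true_and] at hz
            by_contra! hcon
            refine hc1 ⟨?_, ?_⟩
            · rw [← hw.2]; simpa using hcon.1
            · rw [← hz]; simpa using hcon.2
          refine (mono (fun z => fun w => ind (T₂ c.1 z (E (f w) (y' c.1 z))) (E w (y c.1 z)))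
            (fun z w => abs_ind_le _ _) (fun z w => ind_nonneg _ _) ?_).trans
            (sum_ev_test_le hn₁ hn₂ hW hE (V c) hc (Z c.1 β) h (hy c.1) ?_ (T₂ c.1) hτ (hT₂ c.1))
          · intro z hz w hw hb
            have h3 := hdiff z hz w hw
            refine ind_of_mem ?_
            obtain ⟨h1, -⟩ := hw
            rw [← h1] at h3 ⊢
            exact hbad₂ w z hb h3
          · by_cases hc2 : c.2 = true
            · right
              intro z hz hyz
              refine hc1 ⟨hc2, ?_⟩
              simp only [hZ, Finset.mem_filter, Finset.mem_univ, true_and] at hz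
              rw [← hz]; simpa using hyz
            · left
              intro w hw hfw
              exact hc2 (by rw [← hw.2]; simpa using hfw)
      exact hkey.trans (mul_le_mul_of_nonneg_left (by linarith) hQ)
  have hcell : ∀ c : Λ × Bool, ∑ z, ev W (fun w => ind (V c) w * ind (bad z) w) ≤
      (2 : ℝ) ^ (-s) * Fintype.card U +
        ev W (ind (V c)) * (Fintype.card U * (ε + τ) + 2 * (2 : ℝ) ^ k₂) := by
    intro c
    have hQ : 0 ≤ ev W (ind (V c)) := ev_nonneg _ (ind_nonneg _)
    -- Cells lighter than `2 ^ (-s)` are given up; as there are `2 * |Λ|` cells, this is the first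
    -- term of the bound.
    rcases lt_or_ge (ev W (ind (V c))) ((2 : ℝ) ^ (-s)) with h | h
    · calc _ ≤ ∑ z : U, ev W (ind (V c)) := Finset.sum_le_sum fun z _ => ev_ind_mul_ind_le _ _ _
        _ = ev W (ind (V c)) * Fintype.card U := by
            rw [Finset.sum_const, nsmul_eq_mul, mul_comm, Finset.card_univ]
        _ ≤ (2 : ℝ) ^ (-s) * Fintype.card U := by gcongr
        _ ≤ _ := le_add_of_nonneg_right (by positivity)
    · have hZs : ∀ φ : U → ℝ, ∑ z, φ z = ∑ z ∈ Z c.1 true, φ z + ∑ z ∈ Z c.1 false, φ z := by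
        intro φ
        simp only [hZ, decide_eq_true_eq, decide_eq_false_iff_not]
        exact (Finset.sum_filter_add_sum_filter_not _ _ _).symm
      have hcard : (Fintype.card U : ℝ) = (Z c.1 true).card + (Z c.1 false).card := by
        simpa using hZs fun _ => 1
      have h3 : 0 ≤ (2 : ℝ) ^ (-s) * Fintype.card U := by positivity
      rw [hZs, hcard]
      rw [hcard] at h3
      have h4 := hpart c true h
      have h5 := hpart c false h
      nlinarith
  have hsplit : ∀ z, ev W (ind (bad z)) = ∑ c, ev W fun w => ind (V c) w * ind (bad z) w := by
    intro z
    rw [← ev_sum W _ fun c w => abs_ind_mul_ind_le (V c) (bad z) w]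
    refine ev_congr _ fun w => ?_
    rw [← Finset.sum_mul, hVsum, one_mul]
  have hQsum : ∑ c, ev W (ind (V c)) = 1 := by
    rw [← ev_sum W _ fun c w => abs_ind_le (V c) w, ev_congr W hVsum, ev_const]
  calc ∑ z, ev W (ind (bad z)) =
        ∑ c, ∑ z, ev W fun w => ind (V c) w * ind (bad z) w := by
        rw [Finset.sum_comm]
        exact Finset.sum_congr rfl fun z _ => hsplit z
    _ ≤ _ := Finset.sum_le_sum fun c _ => hcell c
    _ = _ := by
        rw [Finset.sum_add_distrib, ← Finset.sum_mul _ (fun c => ev W (ind (V c))), hQsum, one_mul]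
        simp only [Finset.sum_const, Finset.card_univ, Fintype.card_prod, Fintype.card_bool,
          nsmul_eq_mul, Nat.cast_mul, Nat.cast_ofNat]
        ring

end NonMalleable

/-! ### The protocol and its runs -/

/-- The ingredients of the protocol: an encoding of messages, a way to split a tape into a first
part in `U`, a seed in `D` and the rest, the derivation of a key `(x, y₁, y₂)` from the secret and
the first parts of both tapes, a hash function for authentication, and a seeded extractor. -/
structure Ingredients (ℓ₁ ℓ m : ℕ) (U D F Rest : Type) where
  len : ℕ
  enc : U × D × F → Bits len
  dec : Bits len → U × D × F
  dec_enc : ∀ c, dec (enc c) = c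
  split : Bits ℓ ≃ U × D × Rest
  key : Bits ℓ₁ → U → U → F × F × F
  hash : F → D → F
  ext : Bits ℓ₁ → D → Bits m

namespace Ingredients

variable {ℓ₁ ℓ m : ℕ} {U D F Rest : Type} [Inhabited U] [AddCommGroup D] [Field F]
  (I : Ingredients ℓ₁ ℓ m U D F Rest)

/-- The first part of a tape. -/
def fst (a : Bits ℓ) : U := (I.split a).1

/-- The seed on a tape. -/
def snd (a : Bits ℓ) : D := (I.split a).2.1

/-- The tag with which Alice authenticates a seed. -/
def tagA (k : F × F × F) (d : D) : F := I.hash k.1 d + k.2.1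

/-- The tag with which Bob authenticates a seed. -/
def tagB (k : F × F × F) (d : D) : F := I.hash k.1 d + k.2.2

/-- The message that carries the first part of a tape. -/
def msgU (u : U) : Bits I.len := I.enc (u, 0, 0)

/-- The message that carries a seed and its tag. -/
def msgT (t : D × F) : Bits I.len := I.enc (default, t)

open Classical in
/-- Alice and Bob exchange the first parts of their tapes, derive keys from these and the secret,
and exchange their seeds, authenticated with the keys. They extract from the secret with the sum
of the seeds. The last two messages are dummies. -/
def protocol : Protocol 6 ℓ₁ ℓ m where
  msgLen := I.len
  sendA w a := fun
    | [] => I.msgU (I.fst a)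
    | [c] => I.msgT (I.snd a, I.tagA (I.key w (I.fst a) (I.dec c).1) (I.snd a))
    | _ => I.msgU default
  sendB w b := fun
    | [_] => I.msgU (I.fst b)
    | [c, _] => I.msgT (I.snd b, I.tagB (I.key w (I.dec c).1 (I.fst b)) (I.snd b))
    | _ => I.msgU default
  outA w a := fun
    | c :: t :: _ =>
      if (I.dec t).2.2 = I.tagB (I.key w (I.fst a) (I.dec c).1) (I.dec t).2.1 then
        some (I.ext w (I.snd a + (I.dec t).2.1)) else none
    | _ => none
  outB w b := fun
    | c :: t :: _ =>
      if (I.dec t).2.2 = I.tagA (I.key w (I.dec c).1 (I.fst b)) (I.dec t).2.1 then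
        some (I.ext w ((I.dec t).2.1 + I.snd b)) else none
    | _ => none

/-- The transcript when the messages `cs` are sent. -/
def deliver (eve : I.protocol.Strategy) (cs : List (Bits I.len)) : I.protocol.View :=
  cs.foldl (fun t c => t ++ [(c, eve t c)]) []

section Run

variable (eve : I.protocol.Strategy)

/-- What Bob receives in round 1. -/
def recv₁ (u : U) : U := (I.dec (eve [] (I.msgU u))).1

/-- What Alice receives in round 2. -/
def recv₂ (u u' : U) : U := (I.dec (eve (I.deliver eve [I.msgU u]) (I.msgU u'))).1

/-- What Bob receives in round 3. -/
def recv₃ (u u' : U) (t : D × F) : D × F :=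
  (I.dec (eve (I.deliver eve [I.msgU u, I.msgU u']) (I.msgT t))).2

/-- What Alice receives in round 4. -/
def recv₄ (u u' : U) (t t' : D × F) : D × F :=
  (I.dec (eve (I.deliver eve [I.msgU u, I.msgU u', I.msgT t]) (I.msgT t'))).2

/-- The view of Eve. -/
def viewOf (u u' : U) (t t' : D × F) : I.protocol.View :=
  I.deliver eve [I.msgU u, I.msgU u', I.msgT t, I.msgT t', I.msgU default, I.msgU default]

variable (x : (Bits ℓ₁ × Bits ℓ) × (Bits ℓ₁ × Bits ℓ))

/-- The key of Alice. -/
def runKeyA : F × F × F :=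
  I.key x.1.1 (I.fst x.1.2) (I.recv₂ eve (I.fst x.1.2) (I.fst x.2.2))

/-- The key of Bob. -/
def runKeyB : F × F × F :=
  I.key x.2.1 (I.recv₁ eve (I.fst x.1.2)) (I.fst x.2.2)

/-- The seed and tag sent by Alice. -/
def runA : D × F := (I.snd x.1.2, I.tagA (I.runKeyA eve x) (I.snd x.1.2))

/-- The seed and tag sent by Bob. -/
def runB : D × F := (I.snd x.2.2, I.tagB (I.runKeyB eve x) (I.snd x.2.2))

/-- The seed and tag received by Bob. -/
def runRecvB : D × F := I.recv₃ eve (I.fst x.1.2) (I.fst x.2.2) (I.runA eve x)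

/-- The seed and tag received by Alice. -/
def runRecvA : D × F :=
  I.recv₄ eve (I.fst x.1.2) (I.fst x.2.2) (I.runA eve x) (I.runB eve x)

/-- The number of rounds is a literal, so the recursive transcript reduces by computation to the
explicit list of messages. -/
theorem view_eq : I.protocol.view eve x =
    I.viewOf eve (I.fst x.1.2) (I.fst x.2.2) (I.runA eve x) (I.runB eve x) := by
  rfl

open Classical in
theorem keyA_eq : I.protocol.keyA eve x =
    if (I.runRecvA eve x).2 = I.tagB (I.runKeyA eve x) (I.runRecvA eve x).1 then
      some (I.ext x.1.1 (I.snd x.1.2 + (I.runRecvA eve x).1)) else none := by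
  rfl

open Classical in
theorem keyB_eq : I.protocol.keyB eve x =
    if (I.runRecvB eve x).2 = I.tagA (I.runKeyB eve x) (I.runRecvB eve x).1 then
      some (I.ext x.2.1 ((I.runRecvB eve x).1 + I.snd x.2.2)) else none := by
  rfl

/-- The event that the messages of the first four rounds are delivered unchanged, when the first
parts are `u`, `u'`, the seeds are `d`, `d'` and both keys are `k`. -/
def Unchanged (u u' : U) (k : F × F × F) (d d' : D) : Prop :=
  I.recv₁ eve u = u ∧ I.recv₂ eve u u' = u' ∧
    I.recv₃ eve u u' (d, I.tagA k d) = (d, I.tagA k d) ∧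
    I.recv₄ eve u u' (d, I.tagA k d) (d', I.tagB k d') = (d', I.tagB k d')

/-- The event that both parties have the same secret and that the messages of the first four
rounds are delivered unchanged. -/
def Honest : Prop :=
  x.1.1 = x.2.1 ∧ I.Unchanged eve (I.fst x.1.2) (I.fst x.2.2)
    (I.key x.1.1 (I.fst x.1.2) (I.fst x.2.2)) (I.snd x.1.2) (I.snd x.2.2)

variable {eve x}

theorem Honest.runA_eq (h : I.Honest eve x) : I.runA eve x =
    (I.snd x.1.2, I.tagA (I.key x.1.1 (I.fst x.1.2) (I.fst x.2.2)) (I.snd x.1.2)) := by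
  rw [runA, runKeyA, h.2.2.1]

theorem Honest.runB_eq (h : I.Honest eve x) : I.runB eve x =
    (I.snd x.2.2, I.tagB (I.key x.1.1 (I.fst x.1.2) (I.fst x.2.2)) (I.snd x.2.2)) := by
  rw [runB, runKeyB, h.2.1, h.1]

theorem Honest.keyA (h : I.Honest eve x) :
    I.protocol.keyA eve x = some (I.ext x.1.1 (I.snd x.1.2 + I.snd x.2.2)) := by
  rw [I.keyA_eq, runRecvA, h.runA_eq, h.runB_eq, h.2.2.2.2, if_pos]
  rw [runKeyA, h.2.2.1]

theorem Honest.keyB (h : I.Honest eve x) :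
    I.protocol.keyB eve x = some (I.ext x.1.1 (I.snd x.1.2 + I.snd x.2.2)) := by
  rw [I.keyB_eq, runRecvB, h.runA_eq, h.2.2.2.1, if_pos, ← h.1]
  rw [runKeyB, h.2.1, h.1]

theorem Honest.view (h : I.Honest eve x) : I.protocol.view eve x =
    I.viewOf eve (I.fst x.1.2) (I.fst x.2.2)
      (I.snd x.1.2, I.tagA (I.key x.1.1 (I.fst x.1.2) (I.fst x.2.2)) (I.snd x.1.2))
      (I.snd x.2.2, I.tagB (I.key x.1.1 (I.fst x.1.2) (I.fst x.2.2)) (I.snd x.2.2)) := by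
  rw [I.view_eq, h.runA_eq, h.runB_eq]

theorem accept_of_keyA_ne_none (h : I.protocol.keyA eve x ≠ none) :
    (I.runRecvA eve x).2 = I.tagB (I.runKeyA eve x) (I.runRecvA eve x).1 := by
  by_contra hc
  exact h (by rw [I.keyA_eq, if_neg hc])

theorem accept_of_keyB_ne_none (h : I.protocol.keyB eve x ≠ none) :
    (I.runRecvB eve x).2 = I.tagA (I.runKeyB eve x) (I.runRecvB eve x).1 := by
  by_contra hc
  exact h (by rw [I.keyB_eq, if_neg hc])

theorem honest_passiveEve (w : Bits ℓ₁) (a b : Bits ℓ) :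
    I.Honest I.protocol.passiveEve ((w, a), (w, b)) := by
  refine ⟨rfl, ?_, ?_, ?_, ?_⟩ <;>
    simp [recv₁, recv₂, recv₃, recv₄, Protocol.passiveEve, msgU, msgT, I.dec_enc]

end Run

section Uniform

variable [Fintype U] [Fintype D] [Fintype Rest]

theorem ev_unif_split (φ : Bits ℓ → ℝ) : ev (unif ℓ) φ =
    (∑ u, ∑ d, ∑ c, φ (I.split.symm (u, d, c))) /
      (Fintype.card U * (Fintype.card D * Fintype.card Rest)) := by
  have h1 : (2 : ℝ) ^ ℓ = Fintype.card U * (Fintype.card D * Fintype.card Rest) := by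
    have := Fintype.card_congr I.split
    simp only [Fintype.card_prod, Fintype.card_fun, Fintype.card_bool, Fintype.card_fin] at this
    exact_mod_cast this
  rw [ev_unif, h1, ← I.split.symm.sum_comp, Fintype.sum_prod_type]
  simp only [Fintype.sum_prod_type]

/-- For authentication the first part is the only randomness used from the honest tape; the seed and
the remainder are fixed at worst. The companion for the seed serves secrecy. -/
theorem ev_unif_le_of_sum_fst {φ : Bits ℓ → ℝ} {η : ℝ}
    (h : ∀ d c, ∑ u, φ (I.split.symm (u, d, c)) ≤ Fintype.card U * η) : ev (unif ℓ) φ ≤ η := by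
  have hpos : (0 : ℝ) < Fintype.card U * (Fintype.card D * Fintype.card Rest) := by
    have : Nonempty Rest := ⟨(I.split fun _ => false).2.2⟩
    have h1 : 0 < Fintype.card Rest := Fintype.card_pos
    have h2 : 0 < Fintype.card D := Fintype.card_pos
    have h3 : 0 < Fintype.card U := Fintype.card_pos
    positivity
  rw [I.ev_unif_split, div_le_iff₀ hpos, Finset.sum_comm]
  calc _ = ∑ d, ∑ c, ∑ u, φ (I.split.symm (u, d, c)) :=
        Finset.sum_congr rfl fun d _ => Finset.sum_comm
    _ ≤ ∑ _d : D, ∑ _c : Rest, Fintype.card U * η :=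
        Finset.sum_le_sum fun d _ => Finset.sum_le_sum fun c _ => h d c
    _ = _ := by
        simp only [Finset.sum_const, Finset.card_univ, nsmul_eq_mul]
        ring

theorem ev_unif_le_of_sum_snd {φ : Bits ℓ → ℝ} {η : ℝ}
    (h : ∀ u c, ∑ d, φ (I.split.symm (u, d, c)) ≤ Fintype.card D * η) : ev (unif ℓ) φ ≤ η := by
  have hpos : (0 : ℝ) < Fintype.card U * (Fintype.card D * Fintype.card Rest) := by
    have : Nonempty Rest := ⟨(I.split fun _ => false).2.2⟩
    have h1 : 0 < Fintype.card Rest := Fintype.card_pos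
    have h2 : 0 < Fintype.card D := Fintype.card_pos
    have h3 : 0 < Fintype.card U := Fintype.card_pos
    positivity
  rw [I.ev_unif_split, div_le_iff₀ hpos]
  calc _ = ∑ u, ∑ c, ∑ d, φ (I.split.symm (u, d, c)) :=
        Finset.sum_congr rfl fun d _ => Finset.sum_comm
    _ ≤ ∑ _u : U, ∑ _c : Rest, Fintype.card D * η :=
        Finset.sum_le_sum fun u _ => Finset.sum_le_sum fun c _ => h u c
    _ = _ := by
        simp only [Finset.sum_const, Finset.card_univ, nsmul_eq_mul]
        ring

theorem fst_symm (u : U) (d : D) (c : Rest) : I.fst (I.split.symm (u, d, c)) = u := by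
  simp [fst]

theorem snd_symm (u : U) (d : D) (c : Rest) : I.snd (I.split.symm (u, d, c)) = d := by
  simp [snd]

end Uniform

end Ingredients

theorem eq_unif_of_isSource {n : ℕ} {P : PMF (Bits n)} (h : IsSource (n : ℝ) P) : P = unif n := by
  rw [isSource_iff] at h
  have h2 : ∀ x, (P x).toReal ≤ (unif n x).toReal := by
    intro x
    refine (h x).trans_eq ?_
    rw [unif, PMF.uniformOfFintype_apply]
    simp [Real.rpow_neg]
  have h3 : ∑ x, (P x).toReal = ∑ x, (unif n x).toReal := by
    simpa only [tsum_fintype] using (tsum_toReal P).trans (tsum_toReal (unif n)).symm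
  ext x
  have h4 := (Finset.sum_eq_sum_iff_of_le fun x _ => h2 x).1 h3 x (Finset.mem_univ x)
  exact (ENNReal.toReal_eq_toReal_iff' (P.apply_ne_top x) ((unif n).apply_ne_top x)).1 h4

theorem ind_congr {S T : Type*} {A : Set S} {B : Set T} {a : S} {b : T} (h : a ∈ A ↔ b ∈ B) :
    ind A a = ind B b := by
  by_cases ha : a ∈ A
  · rw [ind_of_mem ha, ind_of_mem (h.1 ha)]
  · rw [ind_of_notMem ha, ind_of_notMem fun hb => ha (h.2 hb)]

namespace Ingredients

variable {ℓ₁ ℓ m : ℕ} {U D F Rest : Type} [Inhabited U] [AddCommGroup D] [Field F]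
  (I : Ingredients ℓ₁ ℓ m U D F Rest) (eve : I.protocol.Strategy)

/-- In an honest run the secrets agree, so the key may be computed from the uncorrupted secret,
whichever party holds it. -/
theorem honest_iff {x : (Bits ℓ₁ × Bits ℓ) × (Bits ℓ₁ × Bits ℓ)} {w : Bits ℓ₁}
    (hw : w = x.1.1 ∨ w = x.2.1) : I.Honest eve x ↔ x.1.1 = x.2.1 ∧
      I.Unchanged eve (I.fst x.1.2) (I.fst x.2.2) (I.key w (I.fst x.1.2) (I.fst x.2.2))
        (I.snd x.1.2) (I.snd x.2.2) := by
  unfold Honest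
  refine and_congr_right fun h => ?_
  have : w = x.1.1 := hw.elim id fun h' => h'.trans h.symm
  rw [this]

/-- A test on the output and the view, given everything that the view depends on. -/
def honestTest (A : Set (Option (Bits m) × I.protocol.View)) (u u' : U) (k : F × F × F)
    (hon : Bool) (d d' : D) : Set (Bits m) :=
  {s | hon = true ∧ I.Unchanged eve u u' k d d' ∧
    (some s, I.viewOf eve u u' (d, I.tagA k d) (d', I.tagB k d')) ∈ A}

/-- The bias restricted to undisturbed runs becomes the bias of a test on the extractor output
alone. Its parameters are the first parts, the seeds, the key and a flag, which is what allows the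
view to be handled as leakage. -/
theorem ind_honest_mul_bias_eq {Ω : Type*} (A : Set (Option (Bits m) × I.protocol.View))
    (x : Ω → (Bits ℓ₁ × Bits ℓ) × (Bits ℓ₁ × Bits ℓ)) (ω : Ω) {w : Bits ℓ₁}
    (hw : w = (x ω).1.1 ∨ w = (x ω).2.1) :
    ind {ω | I.Honest eve (x ω)} ω * bias ((unif m).map some)
        (fun ω => I.protocol.keyA eve (x ω)) (fun ω => I.protocol.view eve (x ω)) A ω =
      ind (I.honestTest eve A (I.fst (x ω).1.2) (I.fst (x ω).2.2)
        (I.key w (I.fst (x ω).1.2) (I.fst (x ω).2.2)) (decide ((x ω).1.1 = (x ω).2.1))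
        (I.snd (x ω).1.2) (I.snd (x ω).2.2)) (I.ext w (I.snd (x ω).1.2 + I.snd (x ω).2.2)) -
      ev (unif m) (ind (I.honestTest eve A (I.fst (x ω).1.2) (I.fst (x ω).2.2)
        (I.key w (I.fst (x ω).1.2) (I.fst (x ω).2.2)) (decide ((x ω).1.1 = (x ω).2.1))
        (I.snd (x ω).1.2) (I.snd (x ω).2.2))) := by
  have hiff := I.honest_iff eve hw
  by_cases h : I.Honest eve (x ω)
  · have h1 := hiff.1 h
    have hww : w = (x ω).1.1 := hw.elim id fun h' => h'.trans h1.1.symm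
    have h2 : ∀ s, ind (I.honestTest eve A (I.fst (x ω).1.2) (I.fst (x ω).2.2)
        (I.key w (I.fst (x ω).1.2) (I.fst (x ω).2.2)) (decide ((x ω).1.1 = (x ω).2.1))
        (I.snd (x ω).1.2) (I.snd (x ω).2.2)) s =
        ind A (some s, I.protocol.view eve (x ω)) := by
      intro s
      have h3 : s ∈ I.honestTest eve A (I.fst (x ω).1.2) (I.fst (x ω).2.2)
          (I.key w (I.fst (x ω).1.2) (I.fst (x ω).2.2)) (decide ((x ω).1.1 = (x ω).2.1))
          (I.snd (x ω).1.2) (I.snd (x ω).2.2) ↔ (some s, I.protocol.view eve (x ω)) ∈ A := by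
        rw [h.view, ← hww]
        exact ⟨fun h => h.2.2, fun h => ⟨decide_eq_true (hww.trans h1.1), h1.2, h⟩⟩
      exact ind_congr h3
    rw [ind_of_mem (T := {ω | I.Honest eve (x ω)}) h, one_mul, bias, h.keyA,
      ev_map _ _ (fun s => abs_ind_le A (s, _)), h2, ev_congr _ h2, ← hww]
  · have h2 : ∀ s, ind (I.honestTest eve A (I.fst (x ω).1.2) (I.fst (x ω).2.2)
        (I.key w (I.fst (x ω).1.2) (I.fst (x ω).2.2)) (decide ((x ω).1.1 = (x ω).2.1))
        (I.snd (x ω).1.2) (I.snd (x ω).2.2)) s = 0 := by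
      intro s
      refine ind_of_notMem fun hs => h (hiff.2 ⟨by simpa using hs.1, hs.2.1⟩)
    rw [ind_of_notMem (T := {ω | I.Honest eve (x ω)}) h, zero_mul, h2, ev_congr _ h2, ev_const,
      sub_zero]

/-! ### Secrecy of the extracted key -/

section KeySecurity

variable [Fintype U] [Fintype D] [Fintype F] [Fintype Rest]

/-- The extracted key is close to uniform if one of the two seeds is uniform, while the other seed
and the tests may depend on leakage. -/
theorem sum_ext_le {Λ : Type*} [Fintype Λ] {θ N k : ℝ} (hθ : 0 ≤ θ)
    (hext : ∀ T : Set (D × Bits m), ∀ s : Finset (Bits ℓ₁),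
      (∀ w ∈ s, θ * Fintype.card D < deviation T (I.ext w)) → (s.card : ℝ) ≤ N)
    {W : PMF (Bits ℓ₁)} (hW : IsSource k W) (leak : Bits ℓ₁ → Λ) (μ : Λ → D)
    (Q : Λ → D → Set (Bits m)) :
    ∑ d, ev W (fun w => ind (Q (leak w) d) (I.ext w (μ (leak w) + d)) -
      ev (unif m) (ind (Q (leak w) d))) ≤
      Fintype.card D * (θ + Fintype.card Λ * ((2 : ℝ) ^ (-k) * N)) := by
  rw [isSource_iff] at hW
  have h1 := sum_deviation_le (fun T => hext T _ fun w hw => (Finset.mem_filter.1 hw).2)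
    (p := fun w => (W w).toReal)
    (fun w => ENNReal.toReal_nonneg) (by rw [← tsum_fintype (L := .unconditional _), tsum_toReal])
    hW hθ leak fun a => {t | t.2 ∈ Q a (t.1 - μ a)}
  rw [mul_comm]
  refine le_trans (le_of_eq ?_) h1
  simp only [ev_fintype W]
  rw [Finset.sum_comm]
  refine Finset.sum_congr rfl fun w _ => ?_
  -- For fixed `w` the leaked seed is a constant, so adding it permutes the seeds and the sum is
  -- again uniform.
  have h2 := Equiv.sum_comp (Equiv.addLeft (μ (leak w))) fun σ =>
    ind {t : D × Bits m | t.2 ∈ Q (leak w) (t.1 - μ (leak w))} (σ, I.ext w σ) -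
      (∑ o, ind {t : D × Bits m | t.2 ∈ Q (leak w) (t.1 - μ (leak w))} (σ, o)) /
        Fintype.card (Bits m)
  rw [← Finset.mul_sum, deviation, ← h2]
  congr 1
  refine Finset.sum_congr rfl fun d _ => ?_
  have h3 : ∀ s, ind {t : D × Bits m | t.2 ∈ Q (leak w) (t.1 - μ (leak w))}
      (Equiv.addLeft (μ (leak w)) d, s) = ind (Q (leak w) d) s := by
    intro s
    refine ind_congr ?_
    simp
  simp only [h3, ev_unif]
  simp

/-- Everything is fixed except `W` and the honest seed. The corrupted first part and seed, the flag
for equal secrets and the key are then functions of `W`; their number of values is the factor in the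
error. -/
theorem ev_honest_bias_le {θ N k : ℝ} (hθ : 0 ≤ θ)
    (hext : ∀ T : Set (D × Bits m), ∀ s : Finset (Bits ℓ₁),
      (∀ w ∈ s, θ * Fintype.card D < deviation T (I.ext w)) → (s.card : ℝ) ≤ N)
    {W : PMF (Bits ℓ₁)} (hW : IsSource k W) (v : Party)
    (G : Bits ℓ₁ × Bits ℓ → Bits ℓ₁ × Bits ℓ) (A : Set (Option (Bits m) × I.protocol.View)) :
    ev (indep W (indep (unif ℓ) (unif ℓ))) (fun ω =>
      ind {ω : Bits ℓ₁ × Bits ℓ × Bits ℓ | I.Honest eve (corrupt v G ω.1 ω.2.1 ω.2.2)} ω *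
      bias ((unif m).map some) (fun ω => I.protocol.keyA eve (corrupt v G ω.1 ω.2.1 ω.2.2))
        (fun ω => I.protocol.view eve (corrupt v G ω.1 ω.2.1 ω.2.2)) A ω) ≤
      θ + Fintype.card (U × D × Bool × F × F × F) * ((2 : ℝ) ^ (-k) * N) := by
  set φ : Bits ℓ₁ × Bits ℓ × Bits ℓ → ℝ := fun ω =>
      ind {ω : Bits ℓ₁ × Bits ℓ × Bits ℓ | I.Honest eve (corrupt v G ω.1 ω.2.1 ω.2.2)} ω *
      bias ((unif m).map some) (fun ω => I.protocol.keyA eve (corrupt v G ω.1 ω.2.1 ω.2.2))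
        (fun ω => I.protocol.view eve (corrupt v G ω.1 ω.2.1 ω.2.2)) A ω with hφ
  have hb : ∀ ω, |φ ω| ≤ 2 := by
    intro ω
    rw [hφ, abs_mul]
    have h1 := abs_ind_le {ω : Bits ℓ₁ × Bits ℓ × Bits ℓ |
      I.Honest eve (corrupt v G ω.1 ω.2.1 ω.2.2)} ω
    have h2 := abs_bias_le ((unif m).map some)
      (fun ω : Bits ℓ₁ × Bits ℓ × Bits ℓ => I.protocol.keyA eve (corrupt v G ω.1 ω.2.1 ω.2.2))
        (fun ω => I.protocol.view eve (corrupt v G ω.1 ω.2.1 ω.2.2)) A ω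
    calc _ ≤ 1 * 2 := mul_le_mul h1 h2 (abs_nonneg _) zero_le_one
      _ = 2 := one_mul 2
  rw [ev_indep_swap _ _ hb]
  cases v with
  | alice =>
    rw [ev_indep _ _ fun ω => abs_ev_le W fun w => hb (w, ω)]
    refine ev_le (unif ℓ) (M := 2) (fun a => abs_ev_le (unif ℓ) fun b => abs_ev_le W fun w => hb _)
      fun a => ?_
    refine I.ev_unif_le_of_sum_snd fun u c => ?_
    refine le_trans (le_of_eq ?_) (I.sum_ext_le hθ hext hW
      (fun w => ((I.fst (G (w, a)).2, I.snd (G (w, a)).2, decide ((G (w, a)).1 = w),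
        I.key w (I.fst (G (w, a)).2) u) : U × D × Bool × F × F × F)) (fun c => c.2.1)
      fun c d => I.honestTest eve A c.1 u c.2.2.2 c.2.2.1 c.2.1 d)
    refine Finset.sum_congr rfl fun d _ => ev_congr W fun w => ?_
    rw [hφ]
    have := I.ind_honest_mul_bias_eq eve A
      (fun ω : Bits ℓ₁ × Bits ℓ × Bits ℓ => corrupt .alice G ω.1 ω.2.1 ω.2.2)
      (w, a, I.split.symm (u, d, c)) (w := w) (Or.inr rfl)
    refine this.trans ?_
    simp only [corrupt, fst_symm, snd_symm]
    congr!
  | bob =>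
    rw [ev_indep_swap _ _ fun ω => abs_ev_le W fun w => hb (w, ω)]
    refine ev_le (unif ℓ) (M := 2) (fun a => abs_ev_le (unif ℓ) fun b => abs_ev_le W fun w => hb _)
      fun b => ?_
    refine I.ev_unif_le_of_sum_snd fun u c => ?_
    refine le_trans (le_of_eq ?_) (I.sum_ext_le hθ hext hW
      (fun w => ((I.fst (G (w, b)).2, I.snd (G (w, b)).2, decide (w = (G (w, b)).1),
        I.key w u (I.fst (G (w, b)).2)) : U × D × Bool × F × F × F)) (fun c => c.2.1)
      fun c d => I.honestTest eve A u c.1 c.2.2.2 c.2.2.1 d c.2.1)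
    refine Finset.sum_congr rfl fun d _ => ev_congr W fun w => ?_
    rw [hφ]
    have := I.ind_honest_mul_bias_eq eve A
      (fun ω : Bits ℓ₁ × Bits ℓ × Bits ℓ => corrupt .bob G ω.1 ω.2.1 ω.2.2)
      (w, I.split.symm (u, d, c), b) (w := w) (Or.inl rfl)
    refine this.trans ?_
    simp only [corrupt, fst_symm, snd_symm, add_comm d]
    congr!

end KeySecurity

/-! ### Authentication of the seeds -/

section Authentication

variable [Fintype U] [Fintype D] [Fintype F] [Fintype Rest]

theorem sum_ind_le_one_of_forall_eq {S : Type*} [Fintype S] (T : Set S)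
    (h : ∀ a ∈ T, ∀ b ∈ T, a = b) : ∑ a, ind T a ≤ 1 := by
  classical
  by_cases hT : ∃ a, a ∈ T
  · obtain ⟨a, ha⟩ := hT
    rw [Finset.sum_eq_single a, ind_of_mem ha]
    · intro b _ hb
      exact ind_of_notMem fun hb' => hb (h b hb' a ha)
    · simp
  · rw [Finset.sum_eq_zero]
    · exact zero_le_one
    · intro a _
      exact ind_of_notMem fun h => hT ⟨a, h⟩

/-- Few keys accept a seed with a tag that does not depend on the key. -/
theorem sum_ind_tagA_le (t : D × F) :
    ∑ k, ind {k : F × F × F | t.2 = I.tagA k t.1} k ≤ (Fintype.card F : ℝ) ^ 2 := by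
  simp only [Fintype.sum_prod_type]
  calc _ = ∑ x : F, ∑ y₂ : F, ∑ y₁ : F, ind {k : F × F × F | t.2 = I.tagA k t.1} (x, y₁, y₂) :=
        Finset.sum_congr rfl fun x _ => Finset.sum_comm
    _ ≤ ∑ _x : F, ∑ _y₂ : F, (1 : ℝ) := by
        refine Finset.sum_le_sum fun x _ => Finset.sum_le_sum fun y₂ _ => ?_
        refine sum_ind_le_one_of_forall_eq {y₁ | (x, y₁, y₂) ∈ {k : F × F × F |
          t.2 = I.tagA k t.1}} fun a ha b hb => ?_
        exact add_left_cancel (ha.symm.trans hb)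
    _ = _ := by simp [sq]

/-- Few keys accept Bob's seed with a tag that depends only on the part of the key that is used by
Alice. -/
theorem sum_ind_tagB_le (t : F → F → D × F) :
    ∑ k, ind {k : F × F × F | (t k.1 k.2.1).2 = I.tagB k (t k.1 k.2.1).1} k ≤
      (Fintype.card F : ℝ) ^ 2 := by
  simp only [Fintype.sum_prod_type]
  calc _ ≤ ∑ _x : F, ∑ _y₁ : F, (1 : ℝ) := by
        refine Finset.sum_le_sum fun x _ => Finset.sum_le_sum fun y₁ _ => ?_
        -- The mask `y₂` is not used in Alice's tag. Hence it determines at most one accepting key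
        -- even though the delivered message may depend on `x` and `y₁`.
        refine sum_ind_le_one_of_forall_eq {y₂ | (x, y₁, y₂) ∈ {k : F × F × F |
          (t k.1 k.2.1).2 = I.tagB k (t k.1 k.2.1).1}} fun a ha b hb => ?_
        exact add_left_cancel (ha.symm.trans hb)
    _ = _ := by simp [sq]

/-- The keys for which both parties accept although some of the last two messages is changed. -/
def forgeries (u u' : U) (d d' : D) : Set (F × F × F) :=
  {k | (I.recv₃ eve u u' (d, I.tagA k d)).2 =
        I.tagA k (I.recv₃ eve u u' (d, I.tagA k d)).1 ∧
      (I.recv₄ eve u u' (d, I.tagA k d) (d', I.tagB k d')).2 =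
        I.tagB k (I.recv₄ eve u u' (d, I.tagA k d) (d', I.tagB k d')).1 ∧
      ¬ (I.recv₃ eve u u' (d, I.tagA k d) = (d, I.tagA k d) ∧
        I.recv₄ eve u u' (d, I.tagA k d) (d', I.tagB k d') = (d', I.tagB k d'))}

/-- The masks are exchanged for the tags `p`, `q` by a bijection. With the tags fixed, the delivered
messages no longer depend on `x`, and acceptance of an altered one prescribes a hash difference,
which few `x` satisfy. An altered tag on an unaltered seed is never accepted. -/
theorem sum_ind_forgeries_le {h : ℝ} (hh : 0 ≤ h)
    (hhash : ∀ d d' : D, d ≠ d' → ∀ t, ∑ x, ind {x | I.hash x d - I.hash x d' = t} x ≤ h)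
    (u u' : U) (d d' : D) :
    ∑ k, ind (I.forgeries eve u u' d d') k ≤ 2 * h * (Fintype.card F : ℝ) ^ 2 := by
  have h1 : ∀ t r : D × F, r ≠ t →
      ∑ x, ind {x | r.2 = I.hash x r.1 + (t.2 - I.hash x t.1)} x ≤ h := by
    intro t r hrt
    by_cases hd : r.1 = t.1
    · rw [Finset.sum_eq_zero]
      · exact hh
      · intro x _
        refine ind_of_notMem fun hx => hrt (Prod.ext hd ?_)
        have hx' : r.2 = I.hash x r.1 + (t.2 - I.hash x t.1) := hx
        rw [hx', hd]
        ring
    · refine le_trans (le_of_eq (Finset.sum_congr rfl fun x _ => ?_)) (hhash _ _ hd (r.2 - t.2))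
      refine ind_congr ?_
      constructor
      · intro hx
        have hx' : r.2 = I.hash x r.1 + (t.2 - I.hash x t.1) := hx
        show I.hash x r.1 - I.hash x t.1 = r.2 - t.2
        rw [hx']
        ring
      · intro hx
        have hx' : I.hash x r.1 - I.hash x t.1 = r.2 - t.2 := hx
        show r.2 = I.hash x r.1 + (t.2 - I.hash x t.1)
        linear_combination -hx'
  have h2 : ∀ p q : F, ∑ x, ind (I.forgeries eve u u' d d')
      (x, p - I.hash x d, q - I.hash x d') ≤ 2 * h := by
    intro p q
    set r := I.recv₃ eve u u' (d, p) with hr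
    set r' := I.recv₄ eve u u' (d, p) (d', q) with hr'
    have h3 : ∀ x, (x, p - I.hash x d, q - I.hash x d') ∈ I.forgeries eve u u' d d' ↔
        r.2 = I.hash x r.1 + (p - I.hash x d) ∧ r'.2 = I.hash x r'.1 + (q - I.hash x d') ∧
          ¬ (r = (d, p) ∧ r' = (d', q)) := by
      intro x
      simp only [forgeries, tagA, tagB, Set.mem_ofPred_eq, add_sub_cancel, ← hr, ← hr']
    by_cases hrp : r = (d, p)
    · by_cases hrq : r' = (d', q)
      · rw [Finset.sum_eq_zero]
        · linarith
        · intro x _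
          exact ind_of_notMem fun hx => ((h3 x).1 hx).2.2 ⟨hrp, hrq⟩
      · refine le_trans (Finset.sum_le_sum fun x _ => ?_) ((h1 (d', q) r' hrq).trans (by linarith))
        by_cases hx : (x, p - I.hash x d, q - I.hash x d') ∈ I.forgeries eve u u' d d'
        · rw [ind_of_mem hx, ind_of_mem]
          exact ((h3 x).1 hx).2.1
        · rw [ind_of_notMem hx]
          exact ind_nonneg _ _
    · refine le_trans (Finset.sum_le_sum fun x _ => ?_) ((h1 (d, p) r hrp).trans (by linarith))
      by_cases hx : (x, p - I.hash x d, q - I.hash x d') ∈ I.forgeries eve u u' d d'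
      · rw [ind_of_mem hx, ind_of_mem]
        exact ((h3 x).1 hx).1
      · rw [ind_of_notMem hx]
        exact ind_nonneg _ _
  simp only [Fintype.sum_prod_type]
  calc _ = ∑ x : F, ∑ p : F, ∑ q : F, ind (I.forgeries eve u u' d d')
          (x, p - I.hash x d, q - I.hash x d') := by
        refine Finset.sum_congr rfl fun x _ => ?_
        rw [← (Equiv.subRight (I.hash x d)).sum_comp]
        refine Finset.sum_congr rfl fun p _ => ?_
        rw [← (Equiv.subRight (I.hash x d')).sum_comp]
        rfl
    _ = ∑ p : F, ∑ q : F, ∑ x : F, ind (I.forgeries eve u u' d d')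
          (x, p - I.hash x d, q - I.hash x d') := by
        rw [Finset.sum_comm]
        exact Finset.sum_congr rfl fun p _ => Finset.sum_comm
    _ ≤ ∑ _p : F, ∑ _q : F, 2 * h :=
        Finset.sum_le_sum fun p _ => Finset.sum_le_sum fun q _ => h2 p q
    _ = _ := by
        simp only [Finset.sum_const, Finset.card_univ, nsmul_eq_mul]
        ring

/-- The event that nobody aborts although Eve has interfered. -/
def Fooled (x : (Bits ℓ₁ × Bits ℓ) × (Bits ℓ₁ × Bits ℓ)) : Prop :=
  I.protocol.keyA eve x ≠ none ∧ I.protocol.keyB eve x ≠ none ∧ ¬ I.Honest eve x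

/-- The corrupted tape and all of the honest tape but its first part are fixed, and `sum_ev_bad_le`
is applied to the honest party's key. The three summands account for light leakage cells, for
non-malleability together with forgery, and for small classes of first parts. -/
theorem ev_fooled_le {n₂ m' : ℕ} {E : Bits ℓ₁ → Bits n₂ → Bits m'} (hℓ₁ : 0 < ℓ₁) (hn₂ : 0 < n₂)
    {cat : U → U → Bits n₂} (hcat : ∀ u u' v v', cat u u' = cat v v' → u = v ∧ u' = v')
    {κ : Bits m' → F × F × F}
    (hκ : ∀ T : Set (F × F × F),
      ev (unif m') (ind (κ ⁻¹' T)) = (∑ k, ind T k) / (Fintype.card F : ℝ) ^ 3)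
    (hkey : ∀ w u u', I.key w u u' = κ (E w (cat u u')))
    {h : ℝ} (hh : 1 ≤ 2 * h)
    (hhash : ∀ d d' : D, d ≠ d' → ∀ t, ∑ x, ind {x | I.hash x d - I.hash x d' = t} x ≤ h)
    {W : PMF (Bits ℓ₁)} {k s k₂ ε : ℝ}
    (hW : IsSource k W) (hε : 0 ≤ ε) (hE : NonMalleableGiven (k - s) k₂ ε E fun p => p.2)
    (v : Party) (G : Bits ℓ₁ × Bits ℓ → Bits ℓ₁ × Bits ℓ) :
    ev (indep W (indep (unif ℓ) (unif ℓ)))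
      (ind {ω | I.Fooled eve (corrupt v G ω.1 ω.2.1 ω.2.2)}) ≤
      2 * Fintype.card (U × D) * (2 : ℝ) ^ (-s) + (ε + 2 * h / Fintype.card F) +
        2 * (2 : ℝ) ^ k₂ / Fintype.card U := by
  set τ : ℝ := 2 * h / Fintype.card F with hτ
  have hF : (0 : ℝ) < Fintype.card F := by exact_mod_cast Fintype.card_pos
  have hU : (0 : ℝ) < Fintype.card U := by exact_mod_cast Fintype.card_pos
  have hτ0 : 0 ≤ τ := by positivity
  have hT : ∀ T : Set (F × F × F), ∑ k, ind T k ≤ 2 * h * (Fintype.card F : ℝ) ^ 2 →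
      ev (unif m') (ind (κ ⁻¹' T)) ≤ τ := by
    intro T hT
    rw [hκ, hτ, div_le_div_iff₀ (by positivity) hF]
    calc _ ≤ 2 * h * (Fintype.card F : ℝ) ^ 2 * Fintype.card F := by gcongr
      _ = _ := by ring
  have hT' : ∀ T : Set (F × F × F), ∑ k, ind T k ≤ (Fintype.card F : ℝ) ^ 2 →
      ev (unif m') (ind (κ ⁻¹' T)) ≤ τ := fun T h' => hT T
    (h'.trans (le_mul_of_one_le_left (by positivity) hh))
  have hforge : ∀ u u' d d', ev (unif m') (ind (κ ⁻¹' I.forgeries eve u u' d d')) ≤ τ :=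
    fun u u' d d' => hT _ (I.sum_ind_forgeries_le eve (by linarith) hhash u u' d d')
  have hmem : ∀ x, I.Fooled eve x → x.1.1 = x.2.1 →
      I.recv₁ eve (I.fst x.1.2) = I.fst x.1.2 →
      I.recv₂ eve (I.fst x.1.2) (I.fst x.2.2) = I.fst x.2.2 →
      I.key x.1.1 (I.fst x.1.2) (I.fst x.2.2) ∈ I.forgeries eve (I.fst x.1.2) (I.fst x.2.2)
        (I.snd x.1.2) (I.snd x.2.2) := by
    intro x hx h1 h2 h3
    have hA := I.accept_of_keyA_ne_none hx.1
    have hB := I.accept_of_keyB_ne_none hx.2.1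
    simp only [runRecvA, runRecvB, runA, runB, runKeyA, runKeyB, h2, h3, ← h1] at hA hB
    exact ⟨hB, hA, fun hc => hx.2.2 ⟨h1, h2, h3, hc.1, hc.2⟩⟩
  have hfin : ∀ φ : U → ℝ, ∑ z, φ z ≤ 2 * Fintype.card (U × D) * (2 : ℝ) ^ (-s) *
      Fintype.card U + (Fintype.card U * (ε + τ) + 2 * (2 : ℝ) ^ k₂) →
      ∑ z, φ z ≤ Fintype.card U * (2 * Fintype.card (U × D) * (2 : ℝ) ^ (-s) + (ε + τ) +
        2 * (2 : ℝ) ^ k₂ / Fintype.card U) := by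
    intro φ hφ
    refine hφ.trans_eq ?_
    field_simp
    ring
  rw [ev_indep_swap _ _ (abs_ind_le _)]
  cases v with
  | alice =>
    rw [ev_indep _ _ fun ω => abs_ev_le W fun w => abs_ind_le _ (w, ω)]
    refine ev_le (unif ℓ) (M := 1) (fun a => abs_ev_le (unif ℓ) fun b => abs_ev_le W fun w =>
      abs_ind_le _ _) fun a => ?_
    refine I.ev_unif_le_of_sum_fst fun d c => hfin _ ?_
    refine sum_ev_bad_le (E := E) hℓ₁ hn₂ hW hE
      (fun w => ((I.fst (G (w, a)).2, I.snd (G (w, a)).2) : U × D)) (fun w => (G (w, a)).1)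
      (y := fun p z => cat (I.recv₁ eve p.1) z) (fun p z => cat p.1 (I.recv₂ eve p.1 z))
      (fun p z z' hz => (hcat _ _ _ _ hz).2)
      (fun z => {w | I.Fooled eve (G (w, a), (w, I.split.symm (z, d, c)))})
      (fun p z => κ ⁻¹' I.forgeries eve p.1 z p.2 d)
      -- When the inputs differ, only Bob's check matters: the tag that he receives is determined by
      -- Alice's key `κ e`, and his own key is close to uniform given it.
      (fun p z e => κ ⁻¹' {k | (I.recv₃ eve p.1 z (p.2, I.tagA (κ e) p.2)).2 =
        I.tagA k (I.recv₃ eve p.1 z (p.2, I.tagA (κ e) p.2)).1}) hε hτ0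
      (fun p z => hforge _ _ _ _) (fun p z e => hT' _ (I.sum_ind_tagA_le _)) ?_ ?_
    · intro w z hw hf hy
      obtain ⟨h1, h2⟩ := hcat _ _ _ _ hy
      have := hmem _ hw hf h1.symm (by simpa only [fst_symm] using h2)
      simp only [fst_symm, snd_symm, hkey] at this
      rw [← hy, Set.mem_preimage]
      convert this using 4
      exact hf.symm
    · intro w z hw _
      have hB := I.accept_of_keyB_ne_none hw.2.1
      simp only [runRecvB, runA, runKeyA, runKeyB, fst_symm, hkey] at hB
      exact hB
  | bob =>
    rw [ev_indep_swap _ _ fun ω => abs_ev_le W fun w => abs_ind_le _ (w, ω)]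
    refine ev_le (unif ℓ) (M := 1) (fun a => abs_ev_le (unif ℓ) fun b => abs_ev_le W fun w =>
      abs_ind_le _ _) fun b => ?_
    refine I.ev_unif_le_of_sum_fst fun d c => hfin _ ?_
    refine sum_ev_bad_le (E := E) hℓ₁ hn₂ hW hE
      (fun w => ((I.fst (G (w, b)).2, I.snd (G (w, b)).2) : U × D)) (fun w => (G (w, b)).1)
      (y := fun p z => cat z (I.recv₂ eve z p.1)) (fun p z => cat (I.recv₁ eve z) p.1)
      (fun p z z' hz => (hcat _ _ _ _ hz).1)
      (fun z => {w | I.Fooled eve ((w, I.split.symm (z, d, c)), G (w, b))})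
      (fun p z => κ ⁻¹' I.forgeries eve z p.1 d p.2)
      -- Alice is honest here and her own tag has already been sent, so the reply may depend on `x`
      -- and `y₁` but not on `y₂`.
      (fun p z e => κ ⁻¹' {k |
        (I.recv₄ eve z p.1 (d, I.hash k.1 d + k.2.1) (p.2, I.tagB (κ e) p.2)).2 =
        I.tagB k (I.recv₄ eve z p.1 (d, I.hash k.1 d + k.2.1) (p.2, I.tagB (κ e) p.2)).1}) hε hτ0
      (fun p z => hforge _ _ _ _) (fun p z e => hT' _ (I.sum_ind_tagB_le fun x y₁ =>
        I.recv₄ eve z p.1 (d, I.hash x d + y₁) (p.2, I.tagB (κ e) p.2))) ?_ ?_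
    · intro w z hw hf hy
      obtain ⟨h1, h2⟩ := hcat _ _ _ _ hy
      have := hmem _ hw hf.symm (by simpa only [fst_symm] using h1)
        (by simpa only [fst_symm] using h2.symm)
      simp only [fst_symm, snd_symm, hkey] at this
      rw [Set.mem_preimage]
      convert this using 4
      exact h2.symm
    · intro w z hw _
      have hA := I.accept_of_keyA_ne_none hw.1
      simp only [runRecvA, runA, runB, runKeyA, runKeyB, fst_symm, snd_symm, hkey] at hA
      exact hA

end Authentication

end Ingredients

/-! ### Full-entropy sources and degenerate parameters -/

theorem IsSource.mono {n : ℕ} {k k' : ℝ} {P : PMF (Bits n)} (h : IsSource k P) (hk : k' ≤ k) :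
    IsSource k' P := le_trans hk h

theorem isSource_unif {n : ℕ} {k : ℝ} (hk : k ≤ n) : IsSource k (unif n) := by
  refine IsSource.mono ?_ hk
  rw [isSource_iff]
  intro x
  rw [unif, PMF.uniformOfFintype_apply]
  simp [Real.rpow_neg]

theorem le_of_isSource {n : ℕ} {k : ℝ} {P : PMF (Bits n)} (h : IsSource k P) : k ≤ n := by
  rw [isSource_iff] at h
  have h1 : (1 : ℝ) ≤ 2 ^ n * (2 : ℝ) ^ (-k) := by
    calc (1 : ℝ) = ∑ x, (P x).toReal := by simpa only [tsum_fintype] using (tsum_toReal P).symm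
      _ ≤ ∑ _x : Bits n, (2 : ℝ) ^ (-k) := Finset.sum_le_sum fun x _ => h x
      _ = _ := by simp
  rw [← Real.rpow_natCast, ← Real.rpow_add two_pos, ← Real.rpow_zero 2,
    Real.rpow_le_rpow_left_iff one_lt_two] at h1
  linarith

theorem IsTwoSourceExtractor.nonneg {n₁ n₂ m : ℕ} {k₁ k₂ ε : ℝ} {E : Bits n₁ → Bits n₂ → Bits m}
    (hE : IsTwoSourceExtractor k₁ k₂ ε E) {W : PMF (Bits n₁)} (hW : IsSource k₁ W)
    (hk : k₂ ≤ n₂) : 0 ≤ ε :=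
  (statDist_nonneg _ _).trans (hE W (unif n₂) hW (isSource_unif hk))

/-- The error of a left strong extractor is large if the output is longer than the second
source. -/
theorem NonMalleableGiven.le_error {n₁ n₂ m : ℕ} {k₁ k₂ ε : ℝ} {E : Bits n₁ → Bits n₂ → Bits m}
    (hE : NonMalleableGiven k₁ k₂ ε E fun p => p.1) {W : PMF (Bits n₁)} (hW : IsSource k₁ W)
    (hn₁ : 0 < n₁) (hk : k₂ ≤ n₂) : 1 - 2 ^ n₂ / 2 ^ m ≤ ε := by
  classical
  obtain ⟨f, hf⟩ := exists_fixedPointFree hn₁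
  -- The test asks whether the output lies in the image of `E x`, which has at most `2 ^ n₂`
  -- elements when `x` is revealed.
  set A : Set (Bits m × Bits m × Bits n₁) := {t | ∃ y, E t.2.2 y = t.1} with hA
  refine le_trans ?_ ((ev_bias_le_distGiven (indep W (unif n₂)) (fun p => E p.1 p.2) (unif m)
    (fun p => (E (f p.1) (id p.2), p.1)) A).trans
      (hE W (unif n₂) hW (isSource_unif hk) f id (Or.inl hf)))
  rw [← ev_const (indep W (unif n₂)) (1 - 2 ^ n₂ / 2 ^ m : ℝ)]
  refine ev_mono _ (fun _ => le_refl _) (abs_bias_le _ _ _ _) fun p => ?_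
  rw [bias, ind_of_mem (T := A) ⟨p.2, rfl⟩, ev_unif]
  refine sub_le_sub_left (div_le_div_of_nonneg_right ?_ (by positivity)) _
  calc _ ≤ ∑ s, ∑ y, (if E p.1 y = s then (1 : ℝ) else 0) := by
        refine Finset.sum_le_sum fun s _ => ?_
        have h0 : ∀ y ∈ Finset.univ, (0 : ℝ) ≤ if E p.1 y = s then 1 else 0 := fun y _ => by
          split_ifs <;> norm_num
        by_cases h : ∃ y, E p.1 y = s
        · obtain ⟨y, hy⟩ := h
          refine (ind_le_one _ _).trans ?_
          simpa [hy] using Finset.single_le_sum h0 (Finset.mem_univ y)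
        · rw [ind_of_notMem (T := A) h]
          exact Finset.sum_nonneg h0
    _ = 2 ^ n₂ := by
        rw [Finset.sum_comm]
        simp

/-- If the output has length zero, then nothing has to be sent. -/
theorem exists_protocol_of_eq_zero {ℓ₁ ℓ m : ℕ} (hm : m = 0) :
    ∃ P : Protocol 6 ℓ₁ ℓ m, ∀ k₁ k₂ ε δ : ℝ, 0 ≤ ε → 0 ≤ δ →
      P.IsPrivacyAmplification k₁ k₂ ε δ := by
  subst hm
  have hdist : ∀ {Ω T : Type} (D : PMF Ω) (Z : Ω → T) (ε : ℝ), 0 ≤ ε →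
      distGiven D (fun _ => some fun _ : Fin 0 => false) ((unif 0).map some) Z ≤ ε := by
    intro Ω T D Z ε hε
    refine distGiven_le _ _ _ _ fun A => (le_of_eq ?_).trans hε
    rw [ev_congr D (ψ := fun _ => 0), ev_const]
    intro ω
    rw [bias, ev_map _ _ fun s => abs_ind_le A (s, Z ω),
      ev_congr _ (ψ := fun _ => ind A (some fun _ : Fin 0 => false, Z ω)), ev_const, sub_self]
    intro s
    rw [Subsingleton.elim s fun _ => false]
  refine ⟨⟨0, fun _ _ _ => default, fun _ _ _ => default, fun _ _ _ => some fun _ => false,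
    fun _ _ _ => some fun _ => false⟩, fun k₁ k₂ ε δ hε hδ => ⟨?_, ?_⟩⟩
  · intro W A B _ _ _
    exact ⟨fun ω _ => ⟨rfl, by simp [Protocol.keyA]⟩, hdist _ _ ε hε⟩
  · intro W A B _ _ _ v G R coins eve
    refine ⟨Set.univ, ?_, fun ω _ => Or.inr (Or.inr rfl), fun hH => hdist _ _ ε hε⟩
    rw [toOuterMeasure_toReal, ev_congr _ fun ω => ind_of_mem (Set.mem_univ ω), ev_const]
    linarith

theorem activeSecure_of_one_le {r ℓ₁ ℓ m : ℕ} (P : Protocol r ℓ₁ ℓ m) {k₁ k₂ ε δ : ℝ}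
    (hδ : 1 ≤ δ) : P.ActiveSecure k₁ k₂ ε δ := by
  intro W A B _ _ _ v G R coins eve
  refine ⟨∅, ?_, fun ω h => h.elim, fun hH => ?_⟩
  · simpa using hδ
  · obtain ⟨ω, hω, _⟩ := hH
    exact hω.1.elim

/-! ### From secrecy and authenticity to the security definitions -/

namespace Ingredients

variable {ℓ₁ ℓ m : ℕ} {U D F Rest : Type} [Inhabited U] [AddCommGroup D] [Field F]
  (I : Ingredients ℓ₁ ℓ m U D F Rest)

/-- The output is close to uniform given the view on the event that Eve does not interfere. -/
def HonestSecure (k η : ℝ) : Prop :=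
  ∀ (eve : I.protocol.Strategy) (W : PMF (Bits ℓ₁)), IsSource k W →
    ∀ (v : Party) (G : Bits ℓ₁ × Bits ℓ → Bits ℓ₁ × Bits ℓ)
      (A : Set (Option (Bits m) × I.protocol.View)),
    ev (indep W (indep (unif ℓ) (unif ℓ))) (fun ω =>
      ind {ω : Bits ℓ₁ × Bits ℓ × Bits ℓ | I.Honest eve (corrupt v G ω.1 ω.2.1 ω.2.2)} ω *
      bias ((unif m).map some) (fun ω => I.protocol.keyA eve (corrupt v G ω.1 ω.2.1 ω.2.2))
        (fun ω => I.protocol.view eve (corrupt v G ω.1 ω.2.1 ω.2.2)) A ω) ≤ η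

/-- Eve can rarely interfere without causing an abort. -/
def Authentic (k β : ℝ) : Prop :=
  ∀ (eve : I.protocol.Strategy) (W : PMF (Bits ℓ₁)), IsSource k W →
    ∀ (v : Party) (G : Bits ℓ₁ × Bits ℓ → Bits ℓ₁ × Bits ℓ),
    ev (indep W (indep (unif ℓ) (unif ℓ)))
      (ind {ω | I.Fooled eve (corrupt v G ω.1 ω.2.1 ω.2.2)}) ≤ β

variable {I}

theorem passiveSecure {k₁ k₂ η ε : ℝ} (h : I.HonestSecure k₁ η) (hk₂ : k₂ = ℓ) (hη : η ≤ ε) :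
    I.protocol.PassiveSecure k₁ k₂ ε := by
  intro W A B hW hA hB
  rw [hk₂] at hA hB
  rw [eq_unif_of_isSource hA, eq_unif_of_isSource hB]
  refine ⟨fun ω _ => ?_, distGiven_le _ _ _ _ fun T => ?_⟩
  · have h1 := I.honest_passiveEve ω.1 ω.2.1 ω.2.2
    rw [h1.keyA, h1.keyB]
    exact ⟨rfl, Option.some_ne_none _⟩
  · refine le_trans (le_of_eq (ev_congr _ fun ω => ?_))
      ((h I.protocol.passiveEve W hW .alice id T).trans hη)
    rw [ind_of_mem, one_mul]
    · rfl
    · exact I.honest_passiveEve ω.1 ω.2.1 ω.2.2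

/-- A run without abort is either undisturbed or fooled. Fooled runs are left out of `G`, so the
part of `G` without abort consists of undisturbed runs only. Eve's coins are independent and can be
fixed. -/
theorem activeSecure {k₁ k₂ η ε β δ ρ : ℝ} (h : I.HonestSecure k₁ η) (hβ : I.Authentic k₁ β)
    (hk₂ : k₂ = ℓ) (hη : 0 ≤ η) (hρ : 0 < ρ) (hε : η / ρ ≤ ε) (hδ : β + ρ ≤ δ) :
    I.protocol.ActiveSecure k₁ k₂ ε δ := by
  classical
  intro W A B hW hA hB v G R coins eve D x SA SB C
  rw [hk₂] at hA hB
  have hDeq : D = indep (indep W (indep (unif ℓ) (unif ℓ))) coins := by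
    show indep (indep W (indep A B)) coins = _
    rw [eq_unif_of_isSource hA, eq_unif_of_isSource hB]
  set H : Set ((Bits ℓ₁ × Bits ℓ × Bits ℓ) × R) := {ω | I.Honest (eve ω.2) (x ω)} with hH
  set T : Set ((Bits ℓ₁ × Bits ℓ × Bits ℓ) × R) := {ω | I.Fooled (eve ω.2) (x ω)} with hT
  have hTβ : ev D (ind T) ≤ β := by
    rw [hDeq, ev_indep_swap _ _ (abs_ind_le T)]
    exact ev_le coins (fun r => abs_ev_le _ fun ω => abs_ind_le T (ω, r))
      fun r => hβ (eve r) W hW v G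
  have hkeys : ∀ ω ∈ H, SA ω ≠ none ∧ SB ω ≠ none ∧ SA ω = SB ω := by
    intro ω hω
    have h1 : SA ω = some _ := Honest.keyA I hω
    have h2 : SB ω = some _ := Honest.keyB I hω
    rw [h1, h2]
    exact ⟨Option.some_ne_none _, Option.some_ne_none _, rfl⟩
  have hG : ∀ S : Set ((Bits ℓ₁ × Bits ℓ × Bits ℓ) × R),
      ev D (fun ω => 1 - ind S ω) ≤ β + ρ → 1 - δ ≤ (D.toOuterMeasure S).toReal := by
    intro S hS
    rw [toOuterMeasure_toReal]
    rw [ev_sub D (fun _ => abs_one.le) (abs_ind_le S), ev_const] at hS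
    linarith
  have hone : ∀ (S : Set ((Bits ℓ₁ × Bits ℓ × Bits ℓ) × R)) ω, |1 - ind S ω| ≤ 1 := by
    intro S ω
    exact abs_le.2 ⟨by linarith [ind_le_one S ω], by linarith [ind_nonneg S ω]⟩
  -- If undisturbed runs are rare, they are dropped from `G` too, at cost `ρ`, and nothing remains
  -- to condition on. Otherwise conditioning divides the bias by more than `ρ`.
  rcases le_or_gt (ev D (ind H)) ρ with hHρ | hHρ
  · refine ⟨{ω | SA ω = none ∨ SB ω = none}, hG _ ?_, fun ω hω => ?_, ?_⟩
    · calc _ ≤ ev D fun ω => ind T ω + ind H ω := by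
            refine ev_mono D (hone _) (M' := 2) (fun ω => ?_) fun ω => ?_
            · rw [abs_of_nonneg (add_nonneg (ind_nonneg _ _) (ind_nonneg _ _))]
              linarith [ind_le_one T ω, ind_le_one H ω]
            · by_cases h1 : ω ∈ {ω | SA ω = none ∨ SB ω = none}
              · rw [ind_of_mem h1]
                linarith [ind_nonneg T ω, ind_nonneg H ω]
              · rw [ind_of_notMem h1]
                by_cases h2 : ω ∈ H
                · rw [ind_of_mem h2]
                  linarith [ind_nonneg T ω]
                · rw [ind_of_mem (T := T)]
                  · linarith [ind_nonneg H ω]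
                  · exact ⟨fun hn => h1 (Or.inl hn), fun hn => h1 (Or.inr hn), h2⟩
        _ = ev D (ind T) + ev D (ind H) := ev_add D (abs_ind_le T) (abs_ind_le H)
        _ ≤ _ := add_le_add hTβ hHρ
    · exact hω.elim Or.inl fun h2 => Or.inr (Or.inl h2)
    · rintro ⟨ω, ⟨h1, h2⟩, _⟩
      exact absurd h1 (not_or.2 h2)
  · refine ⟨{ω | SA ω = none ∨ SB ω = none} ∪ H, hG _ ?_, fun ω hω => ?_, fun hS => ?_⟩
    · refine le_trans (ev_mono D (hone _) (abs_ind_le T) fun ω => ?_) (hTβ.trans (by linarith))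
      by_cases h1 : ω ∈ {ω | SA ω = none ∨ SB ω = none} ∪ H
      · rw [ind_of_mem h1, sub_self]
        exact ind_nonneg T ω
      · rw [ind_of_notMem h1, sub_zero, ind_of_mem (T := T)]
        exact ⟨fun hn => h1 (Or.inl (Or.inl hn)), fun hn => h1 (Or.inl (Or.inr hn)),
          fun hn => h1 (Or.inr hn)⟩
    · rcases hω with (h1 | h1) | h1
      · exact Or.inl h1
      · exact Or.inr (Or.inl h1)
      · exact Or.inr (Or.inr (hkeys ω h1).2.2)
    · refine distGiven_le _ _ _ _ fun Q => ?_
      have hSH : ind (({ω | SA ω = none ∨ SB ω = none} ∪ H) ∩ {ω | SA ω ≠ none ∧ SB ω ≠ none}) =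
          ind H := by
        funext ω
        refine ind_congr ⟨fun h1 => h1.1.resolve_left (not_or.2 h1.2), fun h1 => ⟨Or.inr h1, ?_⟩⟩
        exact ⟨(hkeys ω h1).1, (hkeys ω h1).2.1⟩
      rw [ev_filter, hSH]
      refine le_trans ?_ hε
      have hb : ∀ ω, |ind H ω * bias ((unif m).map some) SA C Q ω| ≤ 2 := by
        intro ω
        rw [abs_mul]
        calc _ ≤ 1 * 2 := mul_le_mul (abs_ind_le H ω) (abs_bias_le _ _ _ _ _) (abs_nonneg _)
              zero_le_one
          _ = 2 := one_mul 2
      have hnum : ev D (fun ω => ind H ω * bias ((unif m).map some) SA C Q ω) ≤ η := by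
        rw [hDeq, ev_indep_swap _ _ hb]
        exact ev_le coins (fun r => abs_ev_le _ fun ω => hb (ω, r))
          fun r => h (eve r) W hW v G Q
      exact div_le_div₀ hη hnum hρ hHρ.le

end Ingredients

/-! ### Instantiation of the ingredients -/

theorem card_bits (n : ℕ) : Fintype.card (Bits n) = 2 ^ n := by simp

theorem exists_encoding (M : Type) [Fintype M] [Nonempty M] :
    ∃ (n : ℕ) (enc : M → Bits n) (dec : Bits n → M), ∀ c, dec (enc c) = c := by
  have h : Fintype.card M ≤ Fintype.card (Bits (Fintype.card M)) := by
    rw [card_bits]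
    exact Nat.lt_two_pow_self.le
  obtain ⟨enc⟩ := Function.Embedding.nonempty_of_card_le h
  exact ⟨_, enc, Function.invFun enc, Function.leftInverse_invFun enc.injective⟩

theorem ev_unif_preimage {n : ℕ} {K Q : Type} [Fintype K] [Fintype Q] [Nonempty Q]
    (e : Bits n ≃ K × Q) (T : Set K) :
    ev (unif n) (ind ((fun r => (e r).1) ⁻¹' T)) = (∑ k, ind T k) / Fintype.card K := by
  have hc : (2 : ℝ) ^ n = Fintype.card K * Fintype.card Q := by
    have := Fintype.card_congr e
    rw [card_bits, Fintype.card_prod] at this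
    exact_mod_cast this
  have hQ : (Fintype.card Q : ℝ) ≠ 0 := by exact_mod_cast Fintype.card_ne_zero
  have h1 : ∑ r, ind ((fun r => (e r).1) ⁻¹' T) r = (∑ k, ind T k) * Fintype.card Q := by
    rw [← Equiv.sum_comp e.symm, Fintype.sum_prod_type, Finset.sum_mul]
    refine Finset.sum_congr rfl fun k _ => ?_
    rw [Finset.sum_congr rfl fun q _ => ind_congr (B := T) (b := k) (by simp)]
    simp [mul_comm]
  rw [ev_unif, hc, h1, mul_div_mul_right _ _ hQ]

/-- The protocol exists whenever the parameters fit. -/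
theorem exists_protocol_of_params {ℓ₁ L α d v m : ℕ} (hd : d ≤ L) (hd1 : 1 ≤ d) (hv : v ≤ α)
    (hv1 : 1 ≤ v) {θ : ℝ} (hθ0 : 0 ≤ θ) (hθ1 : θ ≤ 1)
    (hθ : (2 : ℝ) ^ ℓ₁ * Real.exp (-(θ ^ 2 * 2 ^ d / 4)) ≤ 1)
    (hℓ₁ : 0 < ℓ₁) {k s k₂ ε : ℝ} (hε : 0 ≤ ε)
    (E : Bits ℓ₁ → Bits (2 * L) → Bits (4 * α))
    (hE : NonMalleableGiven (k - s) k₂ ε E fun p => p.2) :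
    ∃ P : Protocol 6 ℓ₁ (2 * L) m, ∀ η β : ℝ,
      θ + 2 ^ L * (2 ^ d * (2 * 2 ^ (3 * v))) * ((2 : ℝ) ^ (-k) * (2 ^ d * 2 ^ m + 2)) ≤ η →
      2 * (2 ^ L * 2 ^ d) * (2 : ℝ) ^ (-s) + (ε + 2 * d / 2 ^ v) + 2 * (2 : ℝ) ^ k₂ / 2 ^ L ≤ β →
      (∀ ε', η ≤ ε' → P.PassiveSecure k (2 * L) ε') ∧
      ∀ ε' ρ δ, 0 < ρ → η / ρ ≤ ε' → β + ρ ≤ δ → P.ActiveSecure k (2 * L) ε' δ := by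
  classical
  have : Fact (Nat.Prime 2) := ⟨Nat.prime_two⟩
  let U := Bits L
  let D := Fin d → ZMod 2
  let F := GaloisField 2 v
  let Rest := Bits (L - d)
  let _ : Fintype F := Fintype.ofFinite F
  have hU : Fintype.card U = 2 ^ L := card_bits L
  have hD : Fintype.card D = 2 ^ d := by simp [D]
  have hF : Fintype.card F = 2 ^ v := by
    rw [← Nat.card_eq_fintype_card]
    exact GaloisField.card 2 v (by omega)
  obtain ⟨len, enc, dec, hdec⟩ := exists_encoding (U × D × F)
  have split : Bits (2 * L) ≃ U × D × Rest := Fintype.equivOfCardEq (by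
    rw [Fintype.card_prod, Fintype.card_prod, card_bits, card_bits, card_bits, hD, ← pow_add,
      ← pow_add]
    congr 1
    omega)
  have cat : U × U ≃ Bits (2 * L) := Fintype.equivOfCardEq (by
    rw [Fintype.card_prod, card_bits, card_bits, ← pow_add]
    congr 1
    omega)
  have conv : D ≃ Bits d := Fintype.equivOfCardEq (by rw [hD, card_bits])
  -- The three field elements take `3 * v ≤ 4 * α` bits; the surplus output of `E` is ignored.
  have keys : Bits (4 * α) ≃ (F × F × F) × Bits (4 * α - 3 * v) := Fintype.equivOfCardEq (by
    rw [Fintype.card_prod, Fintype.card_prod, Fintype.card_prod, card_bits, card_bits, hF,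
      ← pow_add, ← pow_add, ← pow_add]
    congr 1
    omega)
  obtain ⟨e, he⟩ := exists_seededExtractor (W := Bits ℓ₁) (D := D) (O := Bits m) hθ0 hθ1 (by
    rw [card_bits, hD]
    push_cast
    exact hθ)
  let I : Ingredients ℓ₁ (2 * L) m U D F Rest :=
    { len := len
      enc := enc
      dec := dec
      dec_enc := hdec
      split := split
      key := fun w u u' => (keys (E w (cat (u, u')))).1
      hash := fun x a => polyHash x (conv a)
      ext := e }
  refine ⟨I.protocol, fun η β hη hβ => ?_⟩
  have hη0 : 0 ≤ η := le_trans (by positivity) hη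
  have hH : I.HonestSecure k η := by
    intro eve W hW v' G A
    refine (I.ev_honest_bias_le eve hθ0 (N := 2 ^ d * 2 ^ m + 2) (fun T s hs => ?_) hW v' G
      A).trans (le_trans (le_of_eq ?_) hη)
    · have h1 : s.card ≤ 2 ^ d * 2 ^ m + 2 := by
        refine (Finset.card_le_card fun w hw => ?_).trans ((he T).trans_eq ?_)
        · exact Finset.mem_filter.2 ⟨Finset.mem_univ w, hs w hw⟩
        · rw [hD, card_bits]
      exact_mod_cast h1
    · rw [Fintype.card_prod, Fintype.card_prod, Fintype.card_prod, Fintype.card_prod,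
        Fintype.card_prod, hU, hD, hF, Fintype.card_bool]
      push_cast
      ring
  have hB : I.Authentic k β := by
    intro eve W hW v' G
    refine (I.ev_fooled_le eve (E := E) (cat := fun u u' => cat (u, u'))
      (κ := fun r => (keys r).1) hℓ₁ (by omega) (fun u u' v v' h => ?_) (fun T => ?_)
      (fun _ _ _ => rfl) (h := d) ?_ (fun a b hab t => ?_) hW hε hE v' G).trans
        (le_trans (le_of_eq ?_) hβ)
    · simpa using cat.injective h
    · rw [ev_unif_preimage keys T, Fintype.card_prod, Fintype.card_prod]
      push_cast
      congr 1
      ring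
    · have : (1 : ℝ) ≤ d := by exact_mod_cast hd1
      linarith
    · simp only [ind]
      rw [Finset.sum_boole]
      exact_mod_cast card_polyHash_sub_eq (fun h => hab (conv.injective h)) t
    · rw [Fintype.card_prod, hU, hD, hF]
      push_cast
      ring
  have hk : (2 * L : ℝ) = ((2 * L : ℕ) : ℝ) := by push_cast; ring
  exact ⟨fun ε' hε' => Ingredients.passiveSecure hH hk hε', fun ε' ρ δ hρ h1 h2 =>
    Ingredients.activeSecure hH hB hk hη0 hρ h1 h2⟩

/-! ### Numerical estimates -/

theorem two_rpow_le {a b : ℝ} (h : a ≤ b) : (2 : ℝ) ^ a ≤ 2 ^ b :=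
  Real.rpow_le_rpow_of_exponent_le one_le_two h

theorem two_mul_two_rpow (a : ℝ) : 2 * (2 : ℝ) ^ a = 2 ^ (a + 1) := by
  rw [Real.rpow_add_one two_ne_zero, mul_comm]

theorem le_two_rpow_div_sixteen {x : ℝ} (hx : 4096 ≤ x) : x ≤ 2 ^ (x / 16) := by
  have h1 : x / 64 ≤ (2 : ℝ) ^ (x / 32) := by
    rw [Real.rpow_def_of_pos two_pos]
    have h2 := Real.add_one_le_exp (Real.log 2 * (x / 32))
    have h3 := Real.log_two_gt_d9
    nlinarith
  calc x ≤ x / 64 * (x / 64) := by nlinarith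
    _ ≤ (2 : ℝ) ^ (x / 32) * (2 : ℝ) ^ (x / 32) := by gcongr
    _ = _ := by rw [← Real.rpow_add two_pos]; congr 1; ring

/-- A seed of `d` bits suffices for the error `2 ^ (-x / 40)`. -/
theorem two_pow_mul_exp_le_one {n d : ℕ} {x : ℝ} (hn : 1 ≤ n) (hd : x / 8 - 1 ≤ d)
    (hx : 1000 ≤ x) (hnx : 1000 * Real.logb 2 n ≤ x) :
    (2 : ℝ) ^ n * Real.exp (-(((2 : ℝ) ^ (-(x / 40))) ^ 2 * 2 ^ d / 4)) ≤ 1 := by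
  have hn0 : (0 : ℝ) < n := by exact_mod_cast hn
  have h1 : (n : ℝ) ≤ ((2 : ℝ) ^ (-(x / 40))) ^ 2 * 2 ^ d / 4 := by
    have h4 : (4 : ℝ) = 2 ^ (2 : ℝ) := by norm_num
    rw [← Real.rpow_natCast 2 d, ← Real.rpow_natCast _ 2, ← Real.rpow_mul two_pos.le,
      ← Real.rpow_add two_pos, h4, ← Real.rpow_sub two_pos,
      ← Real.logb_le_iff_le_rpow one_lt_two hn0]
    push_cast
    linarith
  calc _ ≤ Real.exp n * Real.exp (-(n : ℝ)) := by
        refine mul_le_mul ?_ (Real.exp_le_exp.2 (neg_le_neg h1)) (Real.exp_pos _).le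
          (Real.exp_pos _).le
        rw [← Real.exp_one_pow]
        gcongr
        linarith [Real.exp_one_gt_d9]
    _ = 1 := by rw [← Real.exp_add, add_neg_cancel, Real.exp_zero]

/-- The distance from uniform on the event that Eve does not interfere. -/
theorem key_error_le {L d v m : ℕ} {k : ℝ} (hd : (d : ℝ) ≤ L / 8) (hv : (v : ℝ) ≤ L / 8)
    (hL : (1000 : ℝ) ≤ L) (hm1 : 1 ≤ m) (hk : 2 * L + m ≤ k) :
    (2 : ℝ) ^ (-(L / 40 : ℝ)) +
      2 ^ L * (2 ^ d * (2 * 2 ^ (3 * v))) * ((2 : ℝ) ^ (-k) * (2 ^ d * 2 ^ m + 2)) ≤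
      (2 : ℝ) ^ (-(L / 50 : ℝ)) := by
  have h1 : (2 ^ d * 2 ^ m + 2 : ℝ) ≤ 2 ^ (d + m + 1) := by
    have h2 : (2 : ℝ) ^ 1 ≤ 2 ^ (d + m) := pow_le_pow_right₀ one_le_two (by omega)
    rw [pow_succ, ← pow_add]
    linarith
  have h2 : (2 : ℝ) ^ L * (2 ^ d * (2 * 2 ^ (3 * v))) * ((2 : ℝ) ^ (-k) * (2 ^ d * 2 ^ m + 2)) ≤
      (2 : ℝ) ^ (-(L / 40 : ℝ)) := by
    calc _ ≤ (2 : ℝ) ^ L * (2 ^ d * (2 * 2 ^ (3 * v))) * ((2 : ℝ) ^ (-k) * 2 ^ (d + m + 1)) := by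
          gcongr
      _ = (2 : ℝ) ^ (L + (d + (1 + 3 * v)) + (-k + (d + m + 1)) : ℝ) := by
          rw [Real.rpow_add two_pos, Real.rpow_add two_pos, Real.rpow_add two_pos,
            Real.rpow_add two_pos 1, Real.rpow_add two_pos (-k), Real.rpow_one]
          have e1 : (2 : ℝ) ^ (3 * v : ℝ) = 2 ^ (3 * v) := by
            rw [← Real.rpow_natCast]; push_cast; rfl
          have e2 : (2 : ℝ) ^ (d + m + 1 : ℝ) = 2 ^ (d + m + 1) := by
            rw [← Real.rpow_natCast]; push_cast; rfl
          rw [e1, e2, Real.rpow_natCast, Real.rpow_natCast]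
      -- The exponent is at most `-L + 2 * d + 3 * v + 2`, since `k ≥ 2 * L + m`; with `d` and `v`
      -- at most `L / 8` this is at most `-3 * L / 8 + 2`.
      _ ≤ _ := two_rpow_le (by linarith)
  calc _ ≤ 2 * (2 : ℝ) ^ (-(L / 40 : ℝ)) := by linarith
    _ = (2 : ℝ) ^ (-(L / 40 : ℝ) + 1) := two_mul_two_rpow _
    _ ≤ _ := two_rpow_le (by linarith)

/-- The entropy loss `s = 2 * L + 2 * γ + 1` that the hypothesis allows pays for the leakage of `L +
d` bits and the extra flag. This is one of the two terms `2 ^ (-γ)` in `δ`; `discard_error_eq` is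
the other. -/
theorem leakage_error_le {L d : ℕ} {γ : ℝ} (hd : d ≤ L) (hγ : 0 ≤ γ) :
    2 * (2 ^ L * 2 ^ d) * (2 : ℝ) ^ (-(2 * L + 2 * γ + 1)) ≤ (2 : ℝ) ^ (-γ) := by
  have hd' : (d : ℝ) ≤ L := by exact_mod_cast hd
  calc _ = (2 : ℝ) ^ (1 + (L + d) + -(2 * L + 2 * γ + 1) : ℝ) := by
        rw [Real.rpow_add two_pos, Real.rpow_add two_pos, Real.rpow_add two_pos, Real.rpow_one,
          Real.rpow_natCast, Real.rpow_natCast]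
    _ ≤ _ := two_rpow_le (by linarith)

theorem discard_error_eq (L : ℕ) (γ : ℝ) :
    2 * (2 : ℝ) ^ (L - γ - 1) / 2 ^ L = (2 : ℝ) ^ (-γ) := by
  rw [two_mul_two_rpow, ← Real.rpow_natCast, ← Real.rpow_sub two_pos]
  congr 1
  ring

/-- The probability of a forgery. -/
theorem forgery_error_le {L d α : ℕ} (hd : (d : ℝ) ≤ L / 8) (hL : (4096 : ℝ) ≤ L)
    (hα : α ≤ L) (hLα : (L : ℝ) ≤ (2 : ℝ) ^ (α / 2 : ℝ)) :
    2 * d / (2 : ℝ) ^ (min α (L / 8)) ≤ (2 : ℝ) ^ (-(α / 100 : ℝ)) := by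
  have hα' : (α : ℝ) ≤ L := by exact_mod_cast hα
  have hα0 : (0 : ℝ) ≤ α := Nat.cast_nonneg _
  rw [div_le_iff₀ (by positivity), ← Real.rpow_natCast, ← Real.rpow_add two_pos]
  -- For small `α` the factor `2 * d` is absorbed by `2 ^ (α / 2)`, which is where `α ≥ 2 * log L`
  -- enters; otherwise by `2 ^ (L / 16)`.
  rcases le_total α (L / 8) with h | h
  · rw [min_eq_left h]
    calc (2 * d : ℝ) ≤ L := by linarith
      _ ≤ _ := hLα
      _ ≤ _ := two_rpow_le (by linarith)
  · rw [min_eq_right h]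
    have h1 : (L : ℝ) / 8 - 1 ≤ (L / 8 : ℕ) := by
      have : (L : ℝ) ≤ 8 * (L / 8 : ℕ) + 8 := by exact_mod_cast (by omega : L ≤ 8 * (L / 8) + 8)
      linarith
    calc (2 * d : ℝ) ≤ L := by linarith
      _ ≤ _ := le_two_rpow_div_sixteen hL
      _ ≤ _ := two_rpow_le (by linarith)

/-- If `α ≥ L`, then `4 * α` output bits far exceed the `2 * L` bits of the second source, and left
strongness forces `ε ≥ 1 - 2 ^ (-α)`. -/
theorem one_le_of_isStrongNonMalleable {ℓ₁ L α : ℕ} {k₁ k₂ ε x : ℝ}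
    {E : Bits ℓ₁ → Bits (2 * L) → Bits (4 * α)} (hE : IsStrongNonMalleable k₁ k₂ ε E)
    {W : PMF (Bits ℓ₁)} (hW : IsSource k₁ W) (hℓ₁ : 0 < ℓ₁) (hk : k₂ ≤ (2 * L : ℕ))
    (hα : L ≤ α) (hx : 0 ≤ x) : 1 ≤ ε + (2 : ℝ) ^ (-(α : ℝ)) + x := by
  have h1 := hE.2.2.le_error hW hℓ₁ hk
  have h2 : (2 : ℝ) ^ (2 * L) / 2 ^ (4 * α) ≤ (2 : ℝ) ^ (-(α : ℝ)) := by
    have hα' : (L : ℝ) ≤ α := by exact_mod_cast hα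
    rw [← Real.rpow_natCast, ← Real.rpow_natCast, ← Real.rpow_sub two_pos]
    refine two_rpow_le ?_
    push_cast
    linarith [(Nat.cast_nonneg α : (0 : ℝ) ≤ α)]
  linarith

end MemTamper

end

/-! ### The theorem: choice of parameters -/

theorem mainTheorem8 :
    ∀ κ : ℝ, 2 < κ → ∃ c : ℝ, 0 < c ∧ ∃ K : ℝ, 0 < K ∧
      ∀ (ℓ₁ ℓ₂ α : ℕ) (k₁ γ ε : ℝ), 0 < γ →
        K * Real.logb 2 ℓ₁ ≤ ℓ₂ → κ * Real.logb 2 ℓ₂ ≤ α →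
        ∀ E : MemTamper.Bits ℓ₁ → MemTamper.Bits (2 * ℓ₂) → MemTamper.Bits (4 * α),
          MemTamper.IsStrongNonMalleable (k₁ - 2 * ℓ₂ - 2 * γ - 1) (ℓ₂ - γ - 1) ε E →
          ∃ P : MemTamper.Protocol 6 ℓ₁ (2 * ℓ₂) ⌊0.999 * (k₁ - 2 * ℓ₂ - γ)⌋₊,
            P.IsPrivacyAmplification k₁ (2 * ℓ₂) ((2 : ℝ) ^ (-(c * ℓ₂)))
              (ε + (2 : ℝ) ^ (-(α : ℝ)) + 2 * (2 : ℝ) ^ (-γ) + (2 : ℝ) ^ (-(c * α))) := by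
  intro κ hκ
  -- Once `ℓ₁ ≥ 2`, this `K` gives `L ≥ 2 ^ 100`, hence `log L ≥ 100` and `α ≥ 200`; then `2 * 2 ^
  -- (-α / 100) ≤ 2 ^ (-α / 200)`.
  refine ⟨1 / 200, by norm_num, 2 ^ 100, by norm_num, ?_⟩
  intro ℓ₁ L α k₁ γ ε hγ hK hα E hE
  have hL0 : (0 : ℝ) ≤ L := Nat.cast_nonneg _
  have hk₂ : (L - γ - 1 : ℝ) ≤ (2 * L : ℕ) := by push_cast; linarith
  by_cases hsrc : ∃ W : PMF (MemTamper.Bits ℓ₁), MemTamper.IsSource k₁ W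
  swap
  -- Without any source of the required entropy both security conditions are vacuous.
  · refine ⟨⟨0, fun _ _ _ => default, fun _ _ _ => default, fun _ _ _ => none,
      fun _ _ _ => none⟩, fun W _ _ hW => (hsrc ⟨W, hW⟩).elim, fun W _ _ hW =>
      (hsrc ⟨W, hW⟩).elim⟩
  obtain ⟨W, hW⟩ := hsrc
  have hW' : MemTamper.IsSource (k₁ - 2 * L - 2 * γ - 1) W := hW.mono (by linarith)
  have hε : 0 ≤ ε := hE.1.1.nonneg hW' hk₂
  set m := ⌊0.999 * (k₁ - 2 * L - γ)⌋₊ with hm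
  rcases Nat.eq_zero_or_pos m with hm0 | hm0
  · obtain ⟨P, hP⟩ := MemTamper.exists_protocol_of_eq_zero (ℓ₁ := ℓ₁) (ℓ := 2 * L) hm0
    exact ⟨P, hP _ _ _ _ (by positivity) (by positivity)⟩
  have hm1 : (m : ℝ) ≤ 0.999 * (k₁ - 2 * L - γ) :=
    Nat.floor_le (Nat.pos_of_floor_pos hm0).le
  have hm1' : (1 : ℝ) ≤ m := by exact_mod_cast hm0
  have hkm : 2 * L + m ≤ k₁ := by linarith
  have hkℓ : k₁ ≤ ℓ₁ := MemTamper.le_of_isSource hW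
  have hℓ₁ : 2 ≤ ℓ₁ := by
    have : (1 : ℝ) < ℓ₁ := by
      norm_num at hm1
      linarith
    exact_mod_cast this
  have hlog : 1 ≤ Real.logb 2 ℓ₁ := by
    rw [Real.le_logb_iff_rpow_le one_lt_two (by positivity), Real.rpow_one]
    exact_mod_cast hℓ₁
  have hL : (2 : ℝ) ^ 100 ≤ L := by linarith
  have hLpos : (0 : ℝ) < L := lt_of_lt_of_le (by positivity) hL
  have hL1 : (4096 : ℝ) ≤ L := le_trans (by norm_num) hL
  have hlogL : 100 ≤ Real.logb 2 L := by
    rw [Real.le_logb_iff_rpow_le one_lt_two hLpos]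
    exact_mod_cast hL
  have hα2 : 2 * Real.logb 2 L ≤ α := le_trans (by nlinarith) hα
  have hα200 : (200 : ℝ) ≤ α := by linarith
  have hLα : (L : ℝ) ≤ (2 : ℝ) ^ (α / 2 : ℝ) := by
    rw [← Real.logb_le_iff_le_rpow one_lt_two hLpos]
    linarith
  have hLnat : 4096 ≤ L := by exact_mod_cast hL1
  have hαnat : 200 ≤ α := by exact_mod_cast hα200
  -- Seeds of `L / 8` bits give extractor error `2 ^ (-L / 40)` and still keep the leakage small;
  -- tags have as many bits as `4 * α` output bits and the leakage bound permit.
  set d := L / 8 with hd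
  set v := min α d with hv
  have hdle : (d : ℝ) ≤ L / 8 := Nat.cast_div_le
  have hdge : (L : ℝ) / 8 - 1 ≤ d := by
    have : (L : ℝ) ≤ 8 * d + 8 := by exact_mod_cast (by omega : L ≤ 8 * d + 8)
    linarith
  have hvd : (v : ℝ) ≤ L / 8 := le_trans (by exact_mod_cast min_le_right α d) hdle
  have hθ1 : (2 : ℝ) ^ (-(L / 40 : ℝ)) ≤ 1 :=
    Real.rpow_le_one_of_one_le_of_nonpos one_le_two (by linarith)
  obtain ⟨P, hP⟩ := MemTamper.exists_protocol_of_params (m := m) (by omega : d ≤ L) (by omega)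
    (min_le_left α d) (by omega) (by positivity) hθ1
    (MemTamper.two_pow_mul_exp_le_one (by omega) hdge (by linarith) (by nlinarith))
    (by omega) hε E (k := k₁) (s := 2 * L + 2 * γ + 1) (k₂ := L - γ - 1) (by
      have h := hE.2.1
      rwa [show k₁ - 2 * L - 2 * γ - 1 = k₁ - (2 * L + 2 * γ + 1) by ring] at h)
  obtain ⟨hpas, hact⟩ := hP _ _
    (MemTamper.key_error_le hdle hvd (by linarith) hm0 hkm) le_rfl
  refine ⟨P, hpas _ (MemTamper.two_rpow_le (by linarith)), ?_⟩
  rcases le_total L α with hLα' | hLα'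
  · refine MemTamper.activeSecure_of_one_le P ?_
    rw [add_assoc]
    exact MemTamper.one_le_of_isStrongNonMalleable hE hW' (by omega) hk₂ hLα' (by positivity)
  · have hαL : (α : ℝ) ≤ L := by exact_mod_cast hLα'
    -- Here `ρ = 2 ^ (-α / 100)` matches the forgery error, and `α ≤ L` ensures that dividing the
    -- bias `2 ^ (-L / 50)` by `ρ` leaves at most `2 ^ (-L / 100)`.
    refine hact _ ((2 : ℝ) ^ (-(α / 100 : ℝ))) _ (by positivity) ?_ ?_
    · rw [← Real.rpow_sub two_pos]
      exact MemTamper.two_rpow_le (by linarith)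
    · have h1 := MemTamper.leakage_error_le (by omega : d ≤ L) hγ.le
      have h2 := MemTamper.discard_error_eq L γ
      have h3 := MemTamper.forgery_error_le hdle hL1 hLα' hLα
      have h4 : 2 * (2 : ℝ) ^ (-(α / 100 : ℝ)) ≤ (2 : ℝ) ^ (-(1 / 200 * α : ℝ)) := by
        rw [MemTamper.two_mul_two_rpow]
        exact MemTamper.two_rpow_le (by linarith)
      have h5 : (0 : ℝ) < (2 : ℝ) ^ (-(α : ℝ)) := by positivity
      linarith
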